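/- There is a universal constant $\epsilon_0>0$ such that for every integer $k\ge 4$ there are constants $C,K>0$ and $c\in\mathbb N$, depending only on $k$, with the following property. Let $T\ge 1$ be an integer, $0<\epsilon\le\epsilon_0$, $\tau\in(0,1)$, and let $n$ be any integer with $$n\;\ge\;2^T\cdot K\,(T/\epsilon)^{c}\cdot\log(2/\tau).$$ Then there is a (possibly randomized, not necessarily efficient) online estimator $A$ for $n$ data points and $T$ rounds such that the following holds for all probability distributions $X_1,\dots,X_T$ on $\mathbb R$ with finite $k$-th moments and $\mathbf E\big[|X_t-\mathbf E[X_t]|^k\big]\le 1$ for every $t$. Let $X=X_1\times\cdots\times X_T$ be their product distribution on $\mathbb R^T$, with mean $\mu^*$. Draw $n$ i.i.d. samples from $X$. A (possibly randomized) adversary inspects all of them and replaces at most $\epsilon n$ of them by arbitrary points of $\mathbb R^T$, giving $x^{(1)},\dots,x^{(n)}$. In round $t=1,\dots,T$ the $t$-th coordinates $x^{(1)}_t,\dots,x^{(n)}_t$ are revealed, and $A$ outputs $\mu_t\in\mathbb R$ computed only from the coordinates revealed in rounds $1,\dots,t$ and from its internal randomness, which is independent of the samples and of the adversary. Then, against every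 such adversary, with probability at least $1-\tau$, $$\|\mu-\mu^*\|_2=\sqrt{\sum_{t=1}^T(\mu_t-\mu^*_t)^2}\;\le\;C\,\epsilon^{1-1/k}.$$ -/

import Mathlib

open MeasureTheory

/-- `n` data points in `ℝ^T`; `x i t` is the coordinate of the `i`-th data point that is revealed
in round `t` (one coordinate per round). -/
abbrev Samples (n T : ℕ) : Type := Fin n → Fin T → ℝ

/-- A (possibly randomized) online estimator for `n` data points and `T` rounds. `estimate s x t`
is the number output after round `t` on data `x` and internal randomness `s`. No bound on the
computational cost is imposed. -/
structure OnlineEstimator (n T : ℕ) where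
  /-- Internal randomness, drawn from `seedLaw` independently of the data. -/
  Seed : Type
  [seedSpace : MeasurableSpace Seed]
  seedLaw : Measure Seed
  [isProbabilityMeasure_seedLaw : IsProbabilityMeasure seedLaw]
  estimate : Seed → Samples n T → Fin T → ℝ
  measurable_estimate : Measurable fun p : Seed × Samples n T => estimate p.1 p.2
  /-- The output of round `t` depends only on the coordinates revealed in rounds up to `t`. -/
  causal : ∀ (s : Seed) (x y : Samples n T) (t : Fin T),
    (∀ i, ∀ r ≤ t, x i r = y i r) → estimate s x t = estimate s y t

attribute [instance] OnlineEstimator.seedSpace OnlineEstimator.isProbabilityMeasure_seedLaw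

/-- Strong contamination: `y` arises from `x` by replacing at most `ε n` of the `n` data points
by arbitrary points. -/
def IsCorruptedVersion {n T : ℕ} (ε : ℝ) (x y : Samples n T) : Prop :=
  ({i | x i ≠ y i}.ncard : ℝ) ≤ ε * n

/-- A strong contamination adversary against `n` i.i.d. samples from `P`, described by the joint law
`κ` of the clean data and the corrupted data: the clean data are i.i.d. from `P`, and the corrupted
data are an `ε`-corrupted version of them. The adversary sees all the clean data and may be
randomized. -/
structure IsStrongContamination {n T : ℕ} (P : Measure (Fin T → ℝ)) (ε : ℝ)
    (κ : Measure (Samples n T × Samples n T)) : Prop where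
  clean : κ.map Prod.fst = Measure.pi fun _ : Fin n => P
  corrupted : ∀ᵐ p ∂κ, IsCorruptedVersion ε p.1 p.2

/-- The mean vector of a distribution on `ℝ^T`. -/
noncomputable def meanVector {T : ℕ} (P : Measure (Fin T → ℝ)) : Fin T → ℝ :=
  fun t => ∫ x, x t ∂P

/-- The Euclidean distance on `ℝ^T`. -/
noncomputable def euclideanError {T : ℕ} (u v : Fin T → ℝ) : ℝ :=
  Real.sqrt (∑ t, (u t - v t) ^ 2)

/-- `A` estimates the mean of `P` under `ε`-corruption in the `T`-round online setting with error
`err`, failure probability `τ` and `n` samples: against every adversary, with probability at least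
`1 - τ` over the clean data, the adversary and the internal randomness of `A`, the estimates
computed from the corrupted data are within Euclidean distance `err` of the mean. -/
def OnlineEstimator.EstimatesMean {n T : ℕ} (A : OnlineEstimator n T) (P : Measure (Fin T → ℝ))
    (ε err τ : ℝ) : Prop :=
  ∀ κ : Measure (Samples n T × Samples n T), IsStrongContamination P ε κ →
    ENNReal.ofReal (1 - τ) ≤
      (κ.prod A.seedLaw)
        {q | euclideanError (A.estimate q.2 q.1.2) (meanVector P) ≤ err}

/-- The distribution `D` on `ℝ` has a finite `k`-th moment, and its `k`-th absolute central moment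
is at most `1`. -/
def CentralMomentLeOne (k : ℕ) (D : Measure ℝ) : Prop :=
  MemLp (fun x : ℝ => x) k D ∧ ∫ x, |x - ∫ y, y ∂D| ^ k ∂D ≤ 1

/-! Randomization first makes the problem discrete. Each coordinate is rounded to an integer after a
uniform shift, which preserves its mean, and is then hidden with probability `1 - 1 / N` for a
constant `N`. The readings form a product law `P` on the countable set `(Option ℤ)^T`, and the
empirical law of the clean readings is `ε`-close to `P` in `ℓ₁` once `n` exceeds `64 E_P[1/Q] log
(2/τ) / ε²` for some fully supported law `Q` (`ofReal_one_sub_le_empiricalDeviation_le`). Heavy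
masking makes `E_P[1/Q] ≤ 2` in every coordinate, hence `2^T` for the product
(`integral_inv_referenceLaw_le`). Corruption then leaves data whose averages of every bounded
function of a whole reading vector are correct up to `3 ε` times its bound (`EmpiricallyClose`).
Everything after this is deterministic.

With `ρ = ε^(-1/k)` and target error of order `E = ε ρ = ε^(1 - 1/k)`, averaging readings clipped at
`ρ` gives error `O(E)` in one round, but such errors could add up to `E √T`. So each round also
forms estimates at the scales `j ≥ 1`: clip at `ρ 2^j`, average over the data points with the same
past, take the median of these cell means. The clipping bias is `O(E / 2^j)`, and scale `j` is
trusted to within radius `D / 2^j`, where `D = O(E)`. The output lies in as many of the initial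
intervals as can be met simultaneously (`exists_mem_nested_intervals`), so its error is governed by
the first interval that misses the mean.

The core is that misses are rare: if round `t` misses first at scale `j`, put `w = 2^(-j)`; then the
`w²` sum to at most `1` (`sum_sq_weight_le_one`). In such a round half of the data have a past on
which the clipped score drifts in one direction by order `E w`. Betting `w` times the centred score
on these pasts gives gain `E w²`, steps bounded by `O(ρ)` because `w` cancels the growth of the
clipping threshold, and variance `O(w²)`. Under `P` the accumulated bets are a martingale of mean
zero. Stopped at level `O(ρ)` it is a bounded function of the readings, so its average over the data
is at most `O(ε ρ) = O(E)`, while few data points are stopped and the rest collect drift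
proportional to `E ∑ w²` (`sum_drift_le`). Summing squared errors then gives `O(E²)` whatever `T`
is. -/

/-! ### Concentration for bounded differences -/

/-- Exponential moment form of McDiarmid's bounded differences inequality. -/
theorem integral_exp_le_of_bounded_differences {Ω : Type*} [MeasurableSpace Ω] (P : Measure Ω)
    [IsProbabilityMeasure P] {c : ℝ} (hc : 0 ≤ c) (l : ℝ) :
    ∀ (n : ℕ) (f : (Fin n → Ω) → ℝ) (B : ℝ), Measurable f → (∀ x, |f x| ≤ B) →
      (∀ x i v, |f (Function.update x i v) - f x| ≤ c) →
      ∫ x, Real.exp (l * (f x - ∫ y, f y ∂(Measure.pi fun _ => P))) ∂(Measure.pi fun _ => P)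
        ≤ Real.exp (n * (l ^ 2 * c ^ 2 / 2)) := by
  intro n
  induction n with
  | zero =>
    intro f B _ _ _
    have h : ∀ x : Fin 0 → Ω, f x = f default := fun x => by rw [Subsingleton.elim x default]
    simp [h]
  | succ n ih =>
    intro f B hf hB hd
    obtain ⟨ω₀⟩ : Nonempty Ω := nonempty_of_isProbabilityMeasure P
    have hB0 : 0 ≤ B := (abs_nonneg _).trans (hB fun _ => ω₀)
    have mp : MeasurePreserving (MeasurableEquiv.piFinSuccAbove (fun _ => Ω) 0)
        (Measure.pi fun _ : Fin (n + 1) => P) (P.prod (Measure.pi fun _ : Fin n => P)) :=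
      measurePreserving_piFinSuccAbove (fun _ => P) 0
    set Q : Measure (Fin n → Ω) := Measure.pi fun _ : Fin n => P with hQ
    let F : Ω × (Fin n → Ω) → ℝ := fun p => f (Fin.cons p.1 p.2)
    have hcons : Measurable fun p : Ω × (Fin n → Ω) => (Fin.cons p.1 p.2 : Fin (n + 1) → Ω) := by
      refine measurable_pi_lambda _ fun i => ?_
      refine Fin.cases ?_ (fun j => ?_) i
      · simpa using measurable_fst
      · simpa [Function.comp_def] using (measurable_pi_apply j).comp measurable_snd
    have hF : Measurable F := hf.comp hcons
    have key : ∀ φ : ℝ → ℝ, ∫ x, φ (f x) ∂(Measure.pi fun _ : Fin (n + 1) => P)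
        = ∫ p, φ (F p) ∂(P.prod Q) := by
      intro φ
      rw [← mp.integral_comp' (g := fun p => φ (F p))]
      refine integral_congr_ae (Filter.Eventually.of_forall fun x => ?_)
      simp only [F]
      congr 2
      simp [MeasurableEquiv.piFinSuccAbove, Fin.insertNthEquiv, Fin.cons_self_tail]
    have bint : ∀ {β : Type _} [MeasurableSpace β] (μ : Measure β) [IsProbabilityMeasure μ]
        (g : β → ℝ) (K : ℝ), Measurable g → (∀ x, |g x| ≤ K) → Integrable g μ := by
      intro β _ μ _ g K hg hK
      exact Integrable.of_bound hg.aestronglyMeasurable K (Filter.Eventually.of_forall hK)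
    let g : Ω → ℝ := fun a => ∫ x, F (a, x) ∂Q
    have hg : Measurable g := (hF.stronglyMeasurable.integral_prod_right).measurable
    have hFi : ∀ a, Integrable (fun x => F (a, x)) Q := fun a =>
      bint Q _ B (hF.comp measurable_prodMk_left) fun x => hB _
    have hgB : ∀ a, |g a| ≤ B := fun a => by
      have := norm_integral_le_of_norm_le_const (μ := Q) (f := fun x => F (a, x)) (C := B)
        (Filter.Eventually.of_forall fun x => hB _)
      simpa using this
    have hgd : ∀ a b, |g a - g b| ≤ c := fun a b => by
      have h1 : g a - g b = ∫ x, (F (a, x) - F (b, x)) ∂Q := (integral_sub (hFi a) (hFi b)).symm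
      rw [h1]
      have := norm_integral_le_of_norm_le_const (μ := Q) (f := fun x => F (a, x) - F (b, x)) (C := c)
        (Filter.Eventually.of_forall fun x => by
          have := hd (Fin.cons b x) 0 a
          rwa [Fin.update_cons_zero] at this)
      simpa using this
    have hmean : ∫ y, f y ∂(Measure.pi fun _ : Fin (n + 1) => P) = ∫ a, g a ∂P := by
      have := key id
      simp only [id] at this
      rw [this, integral_prod _ (bint _ F B hF fun p => hB _)]
    set m := ∫ a, g a ∂P with hm
    have hmB : |m| ≤ B := by
      have := norm_integral_le_of_norm_le_const (μ := P) (f := g) (C := B)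
        (Filter.Eventually.of_forall hgB)
      simpa using this
    have hexpB : ∀ u v : ℝ, |u| ≤ B → |v| ≤ B → |Real.exp (l * (u - v))| ≤ Real.exp (|l| * (2 * B)) := by
      intro u v hu hv
      rw [abs_of_pos (Real.exp_pos _), Real.exp_le_exp]
      calc l * (u - v) ≤ |l| * |u - v| := by rw [← abs_mul]; exact le_abs_self _
        _ ≤ |l| * (2 * B) := by
          gcongr
          calc |u - v| ≤ |u| + |v| := abs_sub _ _
            _ ≤ 2 * B := by linarith
    rw [hmean]
    have h2 := key fun y => Real.exp (l * (y - m))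
    rw [h2, integral_prod _ (bint _ _ (Real.exp (|l| * (2 * B)))
      (by fun_prop) fun p => hexpB _ _ (hB _) hmB)]
    -- With the first coordinate fixed, the induction hypothesis controls the fluctuation around the
    -- conditional mean `g a`; Hoeffding's lemma then controls `g`.
    have inner : ∀ a, ∫ x, Real.exp (l * (F (a, x) - m)) ∂Q
        ≤ Real.exp (l * (g a - m)) * Real.exp (n * (l ^ 2 * c ^ 2 / 2)) := by
      intro a
      have := ih (fun x => F (a, x)) B (hF.comp measurable_prodMk_left) (fun x => hB _) (by
        intro x i v
        have := hd (Fin.cons a x) i.succ v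
        rwa [← Fin.cons_update] at this)
      calc ∫ x, Real.exp (l * (F (a, x) - m)) ∂Q
          = ∫ x, Real.exp (l * (g a - m)) * Real.exp (l * (F (a, x) - g a)) ∂Q := by
            congr 1; ext x; rw [← Real.exp_add]; congr 1; ring
        _ = Real.exp (l * (g a - m)) * ∫ x, Real.exp (l * (F (a, x) - g a)) ∂Q :=
            integral_const_mul _ _
        _ ≤ _ := by gcongr
    obtain ⟨a₀⟩ : Nonempty Ω := ⟨ω₀⟩
    have hoeff : ∫ a, Real.exp (l * (g a - m)) ∂P ≤ Real.exp (l ^ 2 * c ^ 2 / 2) := by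
      -- Every value of `g` is within `c` of `g a₀`. The interval has length `2 * c`, which gives
      -- the exponent `l ^ 2 * c ^ 2 / 2` instead of the sharp `l ^ 2 * c ^ 2 / 8`.
      have hs := ProbabilityTheory.hasSubgaussianMGF_of_mem_Icc (μ := P) (X := g)
        (a := g a₀ - c) (b := g a₀ + c) hg.aemeasurable (Filter.Eventually.of_forall fun a => by
          have := abs_le.mp (hgd a a₀)
          constructor <;> linarith)
      have := hs.mgf_le l
      simp only [ProbabilityTheory.mgf] at this
      refine this.trans (le_of_eq ?_)
      congr 1
      push_cast
      rw [show g a₀ + c - (g a₀ - c) = 2 * c by ring, Real.norm_eq_abs, abs_of_nonneg (by linarith)]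
      ring
    calc ∫ a, ∫ x, Real.exp (l * (F (a, x) - m)) ∂Q ∂P
        ≤ ∫ a, Real.exp (l * (g a - m)) * Real.exp (n * (l ^ 2 * c ^ 2 / 2)) ∂P := by
          refine integral_mono_of_nonneg (Filter.Eventually.of_forall fun a => ?_) ?_
            (Filter.Eventually.of_forall inner)
          · exact integral_nonneg fun x => (Real.exp_pos _).le
          · exact (bint P _ (Real.exp (|l| * (2 * B))) (by fun_prop)
              fun a => hexpB _ _ (hgB a) hmB).mul_const _
      _ = (∫ a, Real.exp (l * (g a - m)) ∂P) * Real.exp (n * (l ^ 2 * c ^ 2 / 2)) :=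
          integral_mul_const _ _
      _ ≤ Real.exp (l ^ 2 * c ^ 2 / 2) * Real.exp (n * (l ^ 2 * c ^ 2 / 2)) := by gcongr
      _ = _ := by rw [← Real.exp_add]; congr 1; push_cast; ring

/-- McDiarmid's bounded differences inequality. -/
theorem measureReal_ge_le_of_bounded_differences {Ω : Type*} [MeasurableSpace Ω] (P : Measure Ω)
    [IsProbabilityMeasure P] {c : ℝ} (hc : 0 < c) {n : ℕ} (hn : 0 < n) (f : (Fin n → Ω) → ℝ)
    (B : ℝ) (hf : Measurable f) (hB : ∀ x, |f x| ≤ B)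
    (hd : ∀ x i v, |f (Function.update x i v) - f x| ≤ c) {s : ℝ} (hs : 0 ≤ s) :
    (Measure.pi fun _ : Fin n => P).real
        {x | s ≤ f x - ∫ y, f y ∂(Measure.pi fun _ => P)}
      ≤ Real.exp (-(s ^ 2 / (2 * n * c ^ 2))) := by
  set Q := Measure.pi fun _ : Fin n => P
  set m := ∫ y, f y ∂Q
  -- The minimizer of `-l * s + n * l ^ 2 * c ^ 2 / 2`.
  set l := s / (n * c ^ 2)
  have hn' : (0 : ℝ) < n := by exact_mod_cast hn
  have hl : 0 ≤ l := by positivity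
  have h1 := ProbabilityTheory.measure_ge_le_exp_mul_mgf (μ := Q) (X := fun x => f x - m) s hl (by
    refine Integrable.of_bound (by fun_prop) (Real.exp (l * (B + |m|)))
      (Filter.Eventually.of_forall fun x => ?_)
    rw [Real.norm_eq_abs, abs_of_pos (Real.exp_pos _), Real.exp_le_exp]
    gcongr
    linarith [neg_abs_le m, le_abs_self (f x), hB x])
  refine h1.trans ?_
  have h2 := integral_exp_le_of_bounded_differences P hc.le l n f B hf hB hd
  simp only [ProbabilityTheory.mgf]
  calc _ ≤ Real.exp (-l * s) * Real.exp (n * (l ^ 2 * c ^ 2 / 2)) := by gcongr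
    _ = _ := by
      rw [← Real.exp_add]
      congr 1
      simp only [l]
      field_simp
      ring

/-! ### Empirical laws on a countable space in `ℓ₁` distance -/

section Empirical

variable {Ω : Type*} [MeasurableSpace Ω] [Countable Ω] [DiscreteMeasurableSpace Ω]

theorem hasSum_measureReal_singleton_mul (P : Measure Ω) {g : Ω → ℝ} (hg : Integrable g P) :
    HasSum (fun ω => P.real {ω} * g ω) (∫ ω, g ω ∂P) := by
  have h := hg
  rw [← Measure.sum_smul_dirac P] at h
  have := hasSum_integral_measure h
  simpa [Measure.sum_smul_dirac, integral_smul_measure, measureReal_def] using this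

theorem integrable_of_forall_abs_le {Ω : Type*} [MeasurableSpace Ω] [DiscreteMeasurableSpace Ω]
    (P : Measure Ω) [IsFiniteMeasure P] {g : Ω → ℝ} {B : ℝ} (hg : ∀ ω, |g ω| ≤ B) :
    Integrable g P :=
  Integrable.of_bound (Measurable.of_discrete).aestronglyMeasurable B
    (Filter.Eventually.of_forall hg)

theorem hasSum_measureReal_singleton (P : Measure Ω) [IsProbabilityMeasure P] :
    HasSum (fun ω => P.real {ω}) 1 := by
  simpa using hasSum_measureReal_singleton_mul P (integrable_const (1 : ℝ))

/-- The fraction of the points `z i` that are equal to `ω`. -/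
noncomputable def frequency {Ω : Type*} {n : ℕ} (z : Fin n → Ω) (ω : Ω) : ℝ :=
  (∑ i, Set.indicator {ω} (fun _ => (1 : ℝ)) (z i)) / n

theorem hasSum_indicator_singleton_mul {Ω : Type*} (v : Ω) (g : Ω → ℝ) :
    HasSum (fun ω => Set.indicator {ω} (fun _ => (1 : ℝ)) v * g ω) (g v) := by
  have := hasSum_single (f := fun ω => Set.indicator {ω} (fun _ => (1 : ℝ)) v * g ω) v (by
    intro ω hω
    simp [hω.symm])
  simpa using this

theorem hasSum_frequency_mul {Ω : Type*} {n : ℕ} (z : Fin n → Ω) (g : Ω → ℝ) :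
    HasSum (fun ω => frequency z ω * g ω) ((∑ i, g (z i)) / n) := by
  have h := (hasSum_sum (s := Finset.univ) fun i _ =>
    hasSum_indicator_singleton_mul (z i) g).div_const (n : ℝ)
  have e : (fun ω => frequency z ω * g ω) = fun ω =>
      (∑ i, Set.indicator {ω} (fun _ => (1 : ℝ)) (z i) * g ω) / n := by
    ext ω
    rw [frequency, ← Finset.sum_mul]
    ring
  rw [e]
  exact h

theorem frequency_nonneg {Ω : Type*} {n : ℕ} (z : Fin n → Ω) (ω : Ω) : 0 ≤ frequency z ω :=
  div_nonneg (Finset.sum_nonneg fun _ _ => Set.indicator_nonneg (fun _ _ => zero_le_one) _)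
    (Nat.cast_nonneg n)

theorem hasSum_frequency {Ω : Type*} {n : ℕ} (hn : 0 < n) (z : Fin n → Ω) :
    HasSum (fun ω => frequency z ω) 1 := by
  have hn' : (n : ℝ) ≠ 0 := by positivity
  simpa [hn'] using hasSum_frequency_mul z fun _ => (1 : ℝ)

/-- The `ℓ₁` distance between the empirical distribution of the points `z i` and `P`. -/
noncomputable def empiricalDeviation (P : Measure Ω) {n : ℕ} (z : Fin n → Ω) : ℝ :=
  ∑' ω, |frequency z ω - P.real {ω}|

variable (P : Measure Ω) [IsProbabilityMeasure P] {n : ℕ}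

theorem summable_abs_frequency_sub (hn : 0 < n) (z : Fin n → Ω) :
    Summable fun ω => |frequency z ω - P.real {ω}| :=
  ((hasSum_frequency hn z).summable.sub (hasSum_measureReal_singleton P).summable).abs

omit [Countable Ω] [DiscreteMeasurableSpace Ω] [IsProbabilityMeasure P] in
theorem empiricalDeviation_nonneg (z : Fin n → Ω) : 0 ≤ empiricalDeviation P z :=
  tsum_nonneg fun _ => abs_nonneg _

theorem empiricalDeviation_le_two (hn : 0 < n) (z : Fin n → Ω) : empiricalDeviation P z ≤ 2 := by
  have h := (hasSum_frequency hn z).add (hasSum_measureReal_singleton P)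
  refine (Summable.tsum_le_tsum (fun ω => ?_) (summable_abs_frequency_sub P hn z)
    h.summable).trans ?_
  · have := frequency_nonneg z ω
    have : 0 ≤ P.real {ω} := measureReal_nonneg
    rw [abs_le]
    constructor <;> linarith
  · rw [h.tsum_eq]
    norm_num

/-- Duality between `ℓ₁` and `ℓ∞`. The deviation controls all bounded test functions at once,
including those chosen after seeing the data. -/
theorem abs_average_sub_integral_le (hn : 0 < n) (z : Fin n → Ω) {g : Ω → ℝ} {B : ℝ}
    (hg : ∀ ω, |g ω| ≤ B) :
    |(∑ i, g (z i)) / n - ∫ ω, g ω ∂P| ≤ B * empiricalDeviation P z := by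
  have h := (hasSum_frequency_mul z g).sub
    (hasSum_measureReal_singleton_mul P (integrable_of_forall_abs_le P hg))
  have hb : ∀ ω, ‖frequency z ω * g ω - P.real {ω} * g ω‖ ≤ B * |frequency z ω - P.real {ω}| := by
    intro ω
    rw [← sub_mul, Real.norm_eq_abs, abs_mul, mul_comm]
    exact mul_le_mul_of_nonneg_right (hg ω) (abs_nonneg _)
  have hs := (summable_abs_frequency_sub P hn z).mul_left B
  rw [← h.tsum_eq, empiricalDeviation, ← tsum_mul_left]
  exact tsum_of_norm_bounded hs.hasSum hb

theorem empiricalDeviation_update (hn : 0 < n) (z : Fin n → Ω) (i : Fin n) (v : Ω) :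
    |empiricalDeviation P (Function.update z i v) - empiricalDeviation P z| ≤ 2 / n := by
  have hn' : (0 : ℝ) < n := by exact_mod_cast hn
  have h1 := summable_abs_frequency_sub P hn (Function.update z i v)
  have h2 := summable_abs_frequency_sub P hn z
  have hs := ((hasSum_indicator_singleton_mul v fun _ => (1 : ℝ)).add
    (hasSum_indicator_singleton_mul (z i) fun _ => (1 : ℝ))).div_const (n : ℝ)
  rw [empiricalDeviation, empiricalDeviation, ← h1.tsum_sub h2, ← Real.norm_eq_abs]
  refine (tsum_of_norm_bounded hs fun ω => ?_).trans (by norm_num)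
  rw [Real.norm_eq_abs]
  refine (abs_abs_sub_abs_le_abs_sub _ _).trans ?_
  have hdiff : frequency (Function.update z i v) ω - P.real {ω} - (frequency z ω - P.real {ω})
      = (Set.indicator {ω} (fun _ => (1 : ℝ)) v - Set.indicator {ω} (fun _ => (1 : ℝ)) (z i)) / n := by
    rw [sub_sub_sub_cancel_right, frequency, frequency, ← sub_div, ← Finset.sum_sub_distrib]
    congr 1
    rw [Finset.sum_eq_single i]
    · simp
    · intro j _ hj
      simp [Function.update_of_ne hj]
    · simp
  rw [hdiff, abs_div, abs_of_pos hn']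
  refine div_le_div_of_nonneg_right ?_ hn'.le
  have a1 : 0 ≤ Set.indicator {ω} (fun _ => (1 : ℝ)) v :=
    Set.indicator_nonneg (fun _ _ => zero_le_one) _
  have a2 : 0 ≤ Set.indicator {ω} (fun _ => (1 : ℝ)) (z i) :=
    Set.indicator_nonneg (fun _ _ => zero_le_one) _
  rw [mul_one, mul_one, abs_le]
  constructor <;> linarith

theorem integral_sq_frequency_sub_le (hn : 0 < n) (ω : Ω) :
    ∫ z, (frequency z ω - P.real {ω}) ^ 2 ∂(Measure.pi fun _ : Fin n => P) ≤ P.real {ω} / n := by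
  have hn' : (0 : ℝ) < n := by exact_mod_cast hn
  set X : Ω → ℝ := Set.indicator {ω} fun _ => (1 : ℝ)
  have hX1 : ∀ v, |X v| ≤ 1 := fun v => by
    by_cases h : v = ω <;> simp [X, h]
  have hX : MemLp X 2 P := MemLp.of_bound (Measurable.of_discrete).aestronglyMeasurable 1
    (Filter.Eventually.of_forall hX1)
  have hXm : ∫ v, X v ∂P = P.real {ω} := by
    simp [X, integral_indicator, measureReal_def]
  have hvar := ProbabilityTheory.variance_sum_pi (μ := fun _ : Fin n => P) (X := fun _ => X)
    fun _ => hX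
  have hXv : ProbabilityTheory.variance X P ≤ P.real {ω} := by
    refine (ProbabilityTheory.variance_le_expectation_sq
      (Measurable.of_discrete).aestronglyMeasurable).trans (le_of_eq ?_)
    rw [← hXm]
    congr 1
    ext v
    by_cases h : v = ω <;> simp [X, h]
  have hmeanS : ∫ z : Fin n → Ω, (∑ i, fun z : Fin n → Ω => X (z i)) z ∂(Measure.pi fun _ => P)
      = n * P.real {ω} := by
    simp only [Finset.sum_apply]
    rw [integral_finsetSum]
    · rw [Finset.sum_congr rfl fun i _ => integral_comp_eval (μ := fun _ : Fin n => P) (i := i)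
        (f := X) (Measurable.of_discrete).aestronglyMeasurable]
      simp [hXm]
    · intro i _
      exact integrable_of_forall_abs_le _ (B := 1) fun z => hX1 _
  rw [ProbabilityTheory.variance_eq_integral (Measurable.of_discrete).aemeasurable, hmeanS] at hvar
  have : ∀ z : Fin n → Ω, (frequency z ω - P.real {ω}) ^ 2
      = ((∑ i, fun z : Fin n → Ω => X (z i)) z - n * P.real {ω}) ^ 2 / n ^ 2 := by
    intro z
    rw [frequency, Finset.sum_apply]
    field_simp
    rfl
  simp_rw [this]
  rw [integral_div, hvar]
  simp only [Finset.sum_const, Finset.card_univ, Fintype.card_fin, nsmul_eq_mul]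
  rw [div_le_div_iff₀ (by positivity) hn']
  nlinarith [mul_le_mul_of_nonneg_left hXv (sq_nonneg (n : ℝ))]

/-- A weighted AM-GM inequality, `|d| ≤ (l d² / q + q / l) / 2` with `q = Q {ω}`, reduces the `ℓ₁`
error to the variances `P {ω} / n`. The weights `Q` keep the sum over an infinite alphabet finite.
-/
theorem integral_empiricalDeviation_le (hn : 0 < n) (Q : Measure Ω) [IsProbabilityMeasure Q]
    (hQ : ∀ ω, 0 < Q.real {ω}) {A : ℝ} (hi : Integrable (fun ω => (Q.real {ω})⁻¹) P)
    (hA : ∫ ω, (Q.real {ω})⁻¹ ∂P ≤ A) {l : ℝ} (hl : 0 < l) :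
    ∫ z, empiricalDeviation P z ∂(Measure.pi fun _ : Fin n => P) ≤ (l * A / n + 1 / l) / 2 := by
  have hn' : (0 : ℝ) < n := by exact_mod_cast hn
  set μ := Measure.pi fun _ : Fin n => P
  have hfr : ∀ (z : Fin n → Ω) ω, |frequency z ω - P.real {ω}| ≤ 2 := fun z ω =>
    ((summable_abs_frequency_sub P hn z).le_tsum ω fun _ _ => abs_nonneg _).trans
      (empiricalDeviation_le_two P hn z)
  have hFi : ∀ ω, Integrable (fun z : Fin n → Ω => |frequency z ω - P.real {ω}|) μ := fun ω =>
    integrable_of_forall_abs_le μ (B := 2) fun z => by rw [abs_abs]; exact hfr z ω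
  have hF2 : ∀ ω, Integrable (fun z : Fin n → Ω => (frequency z ω - P.real {ω}) ^ 2) μ := fun ω =>
    integrable_of_forall_abs_le μ (B := 2 ^ 2) fun z => by
      rw [abs_pow]; exact pow_le_pow_left₀ (abs_nonneg _) (hfr z ω) 2
  have hsum := (((hasSum_measureReal_singleton_mul P hi).mul_left (l / n)).add
    ((hasSum_measureReal_singleton Q).div_const l)).div_const 2
  have hterm : ∀ ω, ∫ z, |frequency z ω - P.real {ω}| ∂μ
      ≤ (l / n * (P.real {ω} * (Q.real {ω})⁻¹) + Q.real {ω} / l) / 2 := by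
    intro ω
    set q := Q.real {ω}
    have hq : 0 < q := hQ ω
    calc ∫ z, |frequency z ω - P.real {ω}| ∂μ
        ≤ ∫ z, (l / q * (frequency z ω - P.real {ω}) ^ 2 + q / l) / 2 ∂μ := by
          refine integral_mono (hFi ω) ((((hF2 ω).const_mul _).add (integrable_const _)).div_const _)
            fun z => ?_
          simp only
          rw [← sq_abs (frequency z ω - P.real {ω})]
          set d := |frequency z ω - P.real {ω}|
          have : (l / q * d ^ 2 + q / l) / 2 - d = (l * d - q) ^ 2 / (2 * l * q) := by
            field_simp
            ring
          have : 0 ≤ (l * d - q) ^ 2 / (2 * l * q) := by positivity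
          linarith
      _ = (l / q * (∫ z, (frequency z ω - P.real {ω}) ^ 2 ∂μ) + q / l) / 2 := by
          rw [integral_div, integral_add ((hF2 ω).const_mul _) (integrable_const _),
            integral_const_mul]
          simp
      _ ≤ (l / q * (P.real {ω} / n) + q / l) / 2 := by
          gcongr
          exact integral_sq_frequency_sub_le P hn ω
      _ = _ := by
          field_simp
  have hsF : Summable fun ω => ∫ z, |frequency z ω - P.real {ω}| ∂μ :=
    Summable.of_nonneg_of_le (fun ω => integral_nonneg fun z => abs_nonneg _) hterm hsum.summable
  simp only [empiricalDeviation]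
  rw [← integral_tsum_of_summable_integral_norm hFi (by simpa using hsF)]
  refine (hsF.tsum_le_tsum hterm hsum.summable).trans ?_
  rw [hsum.tsum_eq]
  have : l / n * ∫ ω, (Q.real {ω})⁻¹ ∂P ≤ l / n * A := by gcongr
  have e : l / n * A = l * A / n := by ring
  linarith

/-- With `n ≥ 64 A log (2 / τ) / ε ^ 2` samples the empirical distribution is `ε`-close to `P`
in `ℓ₁` with probability at least `1 - τ`. -/
theorem ofReal_one_sub_le_empiricalDeviation_le (Q : Measure Ω) [IsProbabilityMeasure Q]
    (hQ : ∀ ω, 0 < Q.real {ω}) {A : ℝ} (hi : Integrable (fun ω => (Q.real {ω})⁻¹) P)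
    (hA : ∫ ω, (Q.real {ω})⁻¹ ∂P ≤ A) (hA1 : 1 ≤ A) {ε τ : ℝ} (hε : 0 < ε) (hτ : 0 < τ)
    (hτ1 : τ < 1) (hn : 64 * A / ε ^ 2 * Real.log (2 / τ) ≤ n) :
    ENNReal.ofReal (1 - τ) ≤
      (Measure.pi fun _ : Fin n => P) {z | empiricalDeviation P z ≤ ε} := by
  have hlog : 1 / 2 ≤ Real.log (2 / τ) := by
    have h1 : Real.log 2 ≤ Real.log (2 / τ) := Real.log_le_log (by norm_num) (by
      rw [le_div_iff₀ hτ]; linarith)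
    have := Real.log_two_gt_d9
    linarith
  have hA0 : 64 * A / ε ^ 2 * (1 / 2) ≤ n := le_trans (by gcongr) hn
  have hn' : (0 : ℝ) < n := lt_of_lt_of_le (by positivity) hA0
  have hn0 : 0 < n := by exact_mod_cast hn'
  set μ := Measure.pi fun _ : Fin n => P
  have hE : ∫ z, empiricalDeviation P z ∂μ ≤ ε / 2 := by
    -- This `l` makes `1 / l` equal to `ε / 2`, and the size of `n` makes the other term at most `ε
    -- / 2` as well.
    have := integral_empiricalDeviation_le P hn0 Q hQ hi hA (l := 2 / ε) (by positivity)
    refine this.trans ?_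
    have h1 : 2 / ε * A / n ≤ ε / 2 := by
      rw [div_le_iff₀ hn']
      calc 2 / ε * A = ε / 2 * (64 * A / ε ^ 2 * (1 / 16)) := by field_simp; norm_num
        _ ≤ ε / 2 * (64 * A / ε ^ 2 * (1 / 2)) := by gcongr; norm_num
        _ ≤ ε / 2 * n := by gcongr
    have h2 : 1 / (2 / ε) = ε / 2 := by field_simp
    linarith
  -- Differences `2 / n` and a deviation of `ε / 2` above the mean give the exponent `n ε² / 32`,
  -- which is at least `log (2 / τ)`.
  have hM := measureReal_ge_le_of_bounded_differences P (c := 2 / n) (by positivity) hn0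
    (fun z => empiricalDeviation P z) 2 Measurable.of_discrete
    (fun z => by
      rw [abs_of_nonneg (empiricalDeviation_nonneg P z)]
      exact empiricalDeviation_le_two P hn0 z)
    (fun z i v => empiricalDeviation_update P hn0 z i v) (s := ε / 2) (by positivity)
  have hexp : Real.exp (-((ε / 2) ^ 2 / (2 * n * (2 / n) ^ 2))) ≤ τ := by
    rw [← Real.le_log_iff_exp_le hτ]
    have h1 : (ε / 2) ^ 2 / (2 * n * (2 / n) ^ 2) = n * ε ^ 2 / 32 := by field_simp; norm_num
    have h2 : Real.log (2 / τ) ≤ n * ε ^ 2 / 32 := by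
      calc Real.log (2 / τ) ≤ 2 * A * Real.log (2 / τ) := by nlinarith
        _ = 64 * A / ε ^ 2 * Real.log (2 / τ) * ε ^ 2 / 32 := by field_simp; norm_num
        _ ≤ n * ε ^ 2 / 32 := by gcongr
    have h3 : -Real.log τ ≤ Real.log (2 / τ) := by
      rw [Real.log_div two_ne_zero hτ.ne']
      have := Real.log_two_gt_d9
      linarith
    rw [h1]
    linarith
  have hsub : {z : Fin n → Ω | empiricalDeviation P z ≤ ε}ᶜ ⊆
      {z | ε / 2 ≤ empiricalDeviation P z - ∫ y, empiricalDeviation P y ∂μ} := by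
    intro z hz
    simp only [Set.mem_compl_iff, Set.mem_ofPred_eq, not_le] at hz ⊢
    linarith
  have hbad : μ.real {z : Fin n → Ω | empiricalDeviation P z ≤ ε}ᶜ ≤ τ :=
    (measureReal_mono hsub).trans (hM.trans hexp)
  rw [probReal_compl_eq_one_sub MeasurableSet.of_discrete] at hbad
  rw [← ofReal_measureReal]
  exact ENNReal.ofReal_le_ofReal (by linarith)

end Empirical

/-! ### Stopped martingales and the drift bound -/

section StoppedSum

variable {T : ℕ} {α : Type*}

/-- Membership in `E` depends only on the coordinates before `t`. -/
def IsPredictableAt (t : Fin T) (E : Set (Fin T → α)) : Prop :=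
  ∀ ω ω' : Fin T → α, (∀ r < t, ω r = ω' r) → (ω ∈ E ↔ ω' ∈ E)

open Classical in
/-- The sum of the `h t (ω t)` over the rounds `t < s` with `ω ∈ G t`, stopped when it leaves
`[-M, M]`. -/
noncomputable def stoppedSum (M : ℝ) (h : Fin T → α → ℝ) (G : Fin T → Set (Fin T → α)) :
    ℕ → (Fin T → α) → ℝ
  | 0, _ => 0
  | s + 1, ω => stoppedSum M h G s ω + if hs : s < T then
      (if |stoppedSum M h G s ω| ≤ M ∧ ω ∈ G ⟨s, hs⟩ then h ⟨s, hs⟩ (ω ⟨s, hs⟩) else 0) else 0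

variable {M L : ℝ} {h : Fin T → α → ℝ} {G : Fin T → Set (Fin T → α)}

theorem stoppedSum_congr (hG : ∀ t, IsPredictableAt t (G t)) :
    ∀ (s : ℕ) (ω ω' : Fin T → α), (∀ r : Fin T, r.val < s → ω r = ω' r) →
      stoppedSum M h G s ω = stoppedSum M h G s ω' := by
  intro s
  induction s with
  | zero => intro _ _ _; rfl
  | succ s ih =>
    intro ω ω' hω
    have h1 := ih ω ω' fun r hr => hω r (by omega)
    rw [stoppedSum, stoppedSum, h1]
    by_cases hs : s < T
    · rw [dif_pos hs, dif_pos hs, hω ⟨s, hs⟩ (Nat.lt_succ_self s)]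
      have hiff : ω ∈ G ⟨s, hs⟩ ↔ ω' ∈ G ⟨s, hs⟩ :=
        hG ⟨s, hs⟩ ω ω' fun r hr => hω r (by have : r.val < s := hr; omega)
      by_cases hc : |stoppedSum M h G s ω'| ≤ M ∧ ω ∈ G ⟨s, hs⟩
      · rw [if_pos hc, if_pos ⟨hc.1, hiff.mp hc.2⟩]
      · rw [if_neg hc, if_neg fun hc' => hc ⟨hc'.1, hiff.mpr hc'.2⟩]
    · rw [dif_neg hs, dif_neg hs]

/-- A step is taken only from inside `[-M, M]`, so the overshoot is at most one step. -/
theorem abs_stoppedSum_le (hM : 0 ≤ M) (hL0 : 0 ≤ L) (hL : ∀ t a, |h t a| ≤ L) (s : ℕ)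
    (ω : Fin T → α) : |stoppedSum M h G s ω| ≤ M + L := by
  induction s with
  | zero => simpa [stoppedSum] using by linarith
  | succ s ih =>
    rw [stoppedSum]
    split_ifs with hs hc
    · exact (abs_add_le _ _).trans (add_le_add hc.1 (hL _ _))
    · simpa using ih
    · simpa using ih

/-- Once outside, the sum is frozen; so every point stopped at any time is counted among those
outside at time `T`. -/
theorem lt_abs_stoppedSum_of_le {s s' : ℕ} (hss : s ≤ s') {ω : Fin T → α}
    (hω : M < |stoppedSum M h G s ω|) : M < |stoppedSum M h G s' ω| := by
  induction s', hss using Nat.le_induction with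
  | base => exact hω
  | succ s' _ ih =>
    rw [stoppedSum]
    have : ¬ (|stoppedSum M h G s' ω| ≤ M) := not_le.mpr ih
    simpa [this] using ih

variable [MeasurableSpace α] [Countable α] [DiscreteMeasurableSpace α] (ν : Fin T → Measure α)
  [∀ t, IsProbabilityMeasure (ν t)]

/-- Such a `g` is a function of the other coordinates, which are independent of `ω t`. This supplies
the martingale property of `stoppedSum`. -/
theorem integral_mul_eval_of_update_eq (t : Fin T) {g : (Fin T → α) → ℝ}
    (hg : ∀ ω v, g (Function.update ω t v) = g ω) (f : α → ℝ) :
    ∫ ω, g ω * f (ω t) ∂(Measure.pi ν) = (∫ ω, g ω ∂(Measure.pi ν)) * ∫ a, f a ∂(ν t) := by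
  classical
  obtain ⟨a₀⟩ : Nonempty α := nonempty_of_isProbabilityMeasure (ν t)
  have hind := ProbabilityTheory.iIndepFun_pi (μ := ν) (X := fun _ a => a)
    fun _ => measurable_id.aemeasurable
  have h2 := hind.indepFun_finset (Finset.univ.erase t) {t} (by simp) fun i => measurable_pi_apply i
  let φ : ((i : (Finset.univ.erase t : Finset (Fin T))) → α) → ℝ := fun r =>
    g fun i => if hi : i ∈ (Finset.univ.erase t : Finset (Fin T)) then r ⟨i, hi⟩ else a₀
  let ψ : ((i : ({t} : Finset (Fin T))) → α) → ℝ := fun r => f (r ⟨t, by simp⟩)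
  have h3 := h2.comp (φ := φ) (ψ := ψ) Measurable.of_discrete Measurable.of_discrete
  have h4 := h3.integral_fun_mul_eq_mul_integral
    (Measurable.of_discrete).aestronglyMeasurable (Measurable.of_discrete).aestronglyMeasurable
  have e1 : ∀ ω : Fin T → α, φ (fun i => ω i) = g ω := by
    intro ω
    simp only [φ]
    rw [← hg ω a₀]
    congr 1
    ext i
    by_cases hi : i = t
    · subst hi; simp
    · simp [hi]
  simp only [Function.comp_apply, e1, ψ] at h4
  rw [h4]
  congr 1
  exact integral_comp_eval (μ := ν) (i := t) (f := f) (Measurable.of_discrete).aestronglyMeasurable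

omit [MeasurableSpace α] [Countable α] [DiscreteMeasurableSpace α] in
theorem stoppedSum_update (hG : ∀ t, IsPredictableAt t (G t)) {s : ℕ} (hs : s < T)
    (ω : Fin T → α) (v : α) :
    stoppedSum M h G s (Function.update ω ⟨s, hs⟩ v) = stoppedSum M h G s ω := by
  refine stoppedSum_congr hG s _ _ fun r hr => ?_
  rw [Function.update_of_ne]
  rintro rfl
  exact lt_irrefl _ hr

omit [MeasurableSpace α] [Countable α] [DiscreteMeasurableSpace α] in
theorem isPredictableAt_running (hG : ∀ t, IsPredictableAt t (G t)) {s : ℕ} (hs : s < T) :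
    IsPredictableAt ⟨s, hs⟩ {ω | |stoppedSum M h G s ω| ≤ M ∧ ω ∈ G ⟨s, hs⟩} := by
  intro ω ω' hω
  have h1 := stoppedSum_congr (M := M) (h := h) hG s ω ω' fun r hr => hω r hr
  simp only [Set.mem_ofPred_eq, h1, hG ⟨s, hs⟩ ω ω' hω]

/-- Each step is an indicator determined by the past times a centred function of the current
coordinate. The step and its product with the past sum integrate to zero, so second moments add, and
the indicator only decreases them. -/
theorem integral_stoppedSum (hM : 0 ≤ M) (hL0 : 0 ≤ L) (hL : ∀ t a, |h t a| ≤ L)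
    (hG : ∀ t, IsPredictableAt t (G t)) (h0 : ∀ t, ∫ a, h t a ∂(ν t) = 0) (s : ℕ) :
    ∫ ω, stoppedSum M h G s ω ∂(Measure.pi ν) = 0 ∧
      ∫ ω, stoppedSum M h G s ω ^ 2 ∂(Measure.pi ν) ≤
        ∑ r ∈ Finset.range s, if hr : r < T then ∫ a, h ⟨r, hr⟩ a ^ 2 ∂(ν ⟨r, hr⟩) else 0 := by
  classical
  induction s with
  | zero => simp [stoppedSum]
  | succ s ih =>
    by_cases hs : s < T
    · set U := stoppedSum M h G s
      set E := {ω | |stoppedSum M h G s ω| ≤ M ∧ ω ∈ G ⟨s, hs⟩}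
      let χ : (Fin T → α) → ℝ := fun ω => if ω ∈ E then 1 else 0
      have hstep : ∀ ω, stoppedSum M h G (s + 1) ω = U ω + χ ω * h ⟨s, hs⟩ (ω ⟨s, hs⟩) := by
        intro ω
        rw [stoppedSum, dif_pos hs]
        simp only [χ, ite_mul, one_mul, zero_mul]
        rfl
      have hχ : ∀ ω v, χ (Function.update ω ⟨s, hs⟩ v) = χ ω := by
        intro ω v
        have := isPredictableAt_running (M := M) (h := h) hG hs (Function.update ω ⟨s, hs⟩ v) ω
          fun r hr => Function.update_of_ne hr.ne _ _
        simp only [χ, E, this]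
      have hU : ∀ ω v, U (Function.update ω ⟨s, hs⟩ v) = U ω := stoppedSum_update hG hs
      have hχ1 : ∀ ω, |χ ω| ≤ 1 := fun ω => by
        simp only [χ]; split_ifs <;> simp
      have hχ2 : ∀ ω, χ ω ^ 2 = χ ω := fun ω => by
        simp only [χ]; split_ifs <;> simp
      have hUb : ∀ ω, |U ω| ≤ M + L := abs_stoppedSum_le hM hL0 hL s
      have bint : ∀ g : (Fin T → α) → ℝ, ∀ B, (∀ ω, |g ω| ≤ B) → Integrable g (Measure.pi ν) :=
        fun g B hB => integrable_of_forall_abs_le _ hB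
      have i1 := bint U _ hUb
      have i2 : Integrable (fun ω => χ ω * h ⟨s, hs⟩ (ω ⟨s, hs⟩)) (Measure.pi ν) :=
        bint _ (1 * L) fun ω => by
          rw [abs_mul]; exact mul_le_mul (hχ1 ω) (hL _ _) (abs_nonneg _) zero_le_one
      have i3 : Integrable (fun ω => U ω ^ 2) (Measure.pi ν) := bint _ ((M + L) ^ 2) fun ω => by
        rw [abs_pow]; exact pow_le_pow_left₀ (abs_nonneg _) (hUb ω) 2
      have i4 : Integrable (fun ω => 2 * U ω * χ ω * h ⟨s, hs⟩ (ω ⟨s, hs⟩)) (Measure.pi ν) :=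
        bint _ (2 * (M + L) * 1 * L) fun ω => by
          rw [abs_mul, abs_mul, abs_mul, abs_two]
          gcongr
          · exact hUb ω
          · exact hχ1 ω
          · exact hL _ _
      have i5 : Integrable (fun ω => χ ω * h ⟨s, hs⟩ (ω ⟨s, hs⟩) ^ 2) (Measure.pi ν) :=
        bint _ (1 * L ^ 2) fun ω => by
          rw [abs_mul, abs_pow]
          exact mul_le_mul (hχ1 ω) (pow_le_pow_left₀ (abs_nonneg _) (hL _ _) 2) (by positivity)
            zero_le_one
      have e2 : ∫ ω, χ ω * h ⟨s, hs⟩ (ω ⟨s, hs⟩) ∂(Measure.pi ν) = 0 := by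
        rw [integral_mul_eval_of_update_eq ν ⟨s, hs⟩ hχ (h ⟨s, hs⟩), h0, mul_zero]
      have e4 : ∫ ω, 2 * U ω * χ ω * h ⟨s, hs⟩ (ω ⟨s, hs⟩) ∂(Measure.pi ν) = 0 := by
        rw [integral_mul_eval_of_update_eq ν ⟨s, hs⟩ (g := fun ω => 2 * U ω * χ ω)
          (fun ω v => by rw [hU, hχ]) (h ⟨s, hs⟩), h0, mul_zero]
      have e5 : ∫ ω, χ ω * h ⟨s, hs⟩ (ω ⟨s, hs⟩) ^ 2 ∂(Measure.pi ν)
          ≤ ∫ a, h ⟨s, hs⟩ a ^ 2 ∂(ν ⟨s, hs⟩) := by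
        rw [integral_mul_eval_of_update_eq ν ⟨s, hs⟩ hχ fun a => h ⟨s, hs⟩ a ^ 2]
        refine mul_le_of_le_one_left (integral_nonneg fun a => sq_nonneg _) ?_
        have := integral_mono (bint χ 1 hχ1) (integrable_const (1 : ℝ))
          fun ω => (le_abs_self _).trans (hχ1 ω)
        simpa using this
      constructor
      · simp_rw [hstep]
        rw [integral_add i1 i2, ih.1, e2, add_zero]
      · have hsq : ∀ ω, stoppedSum M h G (s + 1) ω ^ 2 = U ω ^ 2
            + 2 * U ω * χ ω * h ⟨s, hs⟩ (ω ⟨s, hs⟩) + χ ω * h ⟨s, hs⟩ (ω ⟨s, hs⟩) ^ 2 := by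
          intro ω
          rw [hstep]
          linear_combination (h ⟨s, hs⟩ (ω ⟨s, hs⟩)) ^ 2 * hχ2 ω
        simp_rw [hsq]
        have i34 : Integrable (fun ω => U ω ^ 2 + 2 * U ω * χ ω * h ⟨s, hs⟩ (ω ⟨s, hs⟩))
            (Measure.pi ν) := i3.add i4
        rw [integral_add i34 i5, integral_add i3 i4, e4, Finset.sum_range_succ, dif_pos hs]
        linarith [ih.2]
    · have hstep : ∀ ω, stoppedSum M h G (s + 1) ω = stoppedSum M h G s ω := fun ω => by
        rw [stoppedSum, dif_neg hs, add_zero]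
      simp_rw [hstep]
      rw [Finset.sum_range_succ, dif_neg hs, add_zero]
      exact ih

/-- The points `y i` are `η`-close to the distribution `P` in their averages of bounded
functions. -/
def EmpiricallyClose {Ω : Type*} [MeasurableSpace Ω] {n : ℕ} (y : Fin n → Ω) (P : Measure Ω)
    (η : ℝ) : Prop :=
  ∀ (g : Ω → ℝ) (B : ℝ), (∀ ω, |g ω| ≤ B) → |(∑ i, g (y i)) / n - ∫ ω, g ω ∂P| ≤ η * B

open Classical in
/-- If, in every round `t`, the data `y` exhibit a drift of at least `d t` of the centred
function `h t` on every predictable part of a predictable event that contains half of the data,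
then the total drift is bounded in terms of the distance of `y` to the product distribution. -/
theorem sum_drift_le {n : ℕ} (hn : 0 < n) {y : Fin n → Fin T → α} {η : ℝ}
    (hy : EmpiricallyClose y (Measure.pi ν) η) (hM : 0 < M) (hL0 : 0 ≤ L)
    (hL : ∀ t a, |h t a| ≤ L) (hG : ∀ t, IsPredictableAt t (G t))
    (h0 : ∀ t, ∫ a, h t a ∂(ν t) = 0) {V : ℝ} (hV : ∑ t, ∫ a, h t a ^ 2 ∂(ν t) ≤ V)
    (hVM : V / M ^ 2 + η ≤ 1 / 4) {d : Fin T → ℝ} (hd : ∀ t, 0 ≤ d t)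
    (hhalf : ∀ t, 0 < d t → (n : ℝ) / 2 ≤ (Finset.univ.filter fun i => y i ∈ G t).card)
    (hdrift : ∀ t E, IsPredictableAt t E → E ⊆ G t →
      d t * (Finset.univ.filter fun i => y i ∈ E).card
        ≤ ∑ i ∈ Finset.univ.filter (fun i => y i ∈ E), h t (y i t)) :
    ∑ t, d t ≤ 4 * (η * (M + L)) := by
  have hn' : (0 : ℝ) < n := by exact_mod_cast hn
  obtain ⟨hmean, hsq⟩ := integral_stoppedSum ν hM.le hL0 hL hG h0 T
  replace hsq := hsq.trans_eq
    (Finset.sum_fin_eq_sum_range fun t => ∫ a, h t a ^ 2 ∂(ν t)).symm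
  set U := stoppedSum M h G
  have hUb : ∀ ω, |U T ω| ≤ M + L := abs_stoppedSum_le hM.le hL0 hL T
  -- Chebyshev bounds the probability of having been stopped by `V / M ^ 2`. An indicator is a
  -- bounded test function, so the same holds for the data up to `η`.
  have hdead : ((Finset.univ.filter fun i => M < |U T (y i)|).card : ℝ) ≤ n / 4 := by
    let g : (Fin T → α) → ℝ := fun ω => if M < |U T ω| then 1 else 0
    have hg1 : ∀ ω, |g ω| ≤ 1 := fun ω => by
      simp only [g]; split_ifs <;> simp
    have h1 := (abs_le.mp (hy g 1 hg1)).2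
    have h2 : ∫ ω, g ω ∂(Measure.pi ν) ≤ V / M ^ 2 := by
      calc ∫ ω, g ω ∂(Measure.pi ν) ≤ ∫ ω, U T ω ^ 2 / M ^ 2 ∂(Measure.pi ν) := by
            refine integral_mono (integrable_of_forall_abs_le _ hg1)
              (integrable_of_forall_abs_le _ (B := (M + L) ^ 2 / M ^ 2) fun ω => ?_) fun ω => ?_
            · rw [abs_div, abs_pow, abs_pow, abs_of_pos hM]
              gcongr
              exact hUb ω
            · simp only [g]
              split_ifs with hc
              · rw [le_div_iff₀ (by positivity), one_mul, ← sq_abs (U T ω)]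
                gcongr
              · positivity
        _ = (∫ ω, U T ω ^ 2 ∂(Measure.pi ν)) / M ^ 2 := integral_div _ _
        _ ≤ V / M ^ 2 := by
            gcongr
            exact hsq.trans hV
    have h3 : ∑ i, g (y i) = (Finset.univ.filter fun i => M < |U T (y i)|).card := by
      simp [g, Finset.sum_boole]
    rw [h3] at h1
    have h4 : ((Finset.univ.filter fun i => M < |U T (y i)|).card : ℝ) / n ≤ 1 / 4 := by linarith
    rw [div_le_iff₀ hn'] at h4
    linarith
  have hlow : ∀ s, (n : ℝ) / 4 * (∑ r ∈ Finset.range s, if hr : r < T then d ⟨r, hr⟩ else 0)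
      ≤ ∑ i, U s (y i) := by
    intro s
    induction s with
    | zero => simp [U, stoppedSum]
    | succ s ih =>
      rw [Finset.sum_range_succ]
      by_cases hs : s < T
      · obtain ⟨E, hE⟩ : ∃ E, E = {ω | |U s ω| ≤ M ∧ ω ∈ G ⟨s, hs⟩} := ⟨_, rfl⟩
        have hmem : ∀ ω, ω ∈ E ↔ |U s ω| ≤ M ∧ ω ∈ G ⟨s, hs⟩ := fun ω => by rw [hE]; rfl
        have hstep : ∀ ω, U (s + 1) ω = U s ω + if ω ∈ E then h ⟨s, hs⟩ (ω ⟨s, hs⟩) else 0 := by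
          intro ω
          simp only [U]
          rw [stoppedSum, dif_pos hs]
          congr 1
          exact if_congr (hmem ω).symm rfl rfl
        simp_rw [hstep]
        rw [Finset.sum_add_distrib, ← Finset.sum_filter, dif_pos hs, mul_add]
        refine add_le_add ih ?_
        have hdr := hdrift ⟨s, hs⟩ E (hE ▸ isPredictableAt_running hG hs)
          fun ω hω => ((hmem ω).mp hω).2
        refine le_trans ?_ hdr
        rcases (hd ⟨s, hs⟩).eq_or_lt with hz | hpos
        · rw [← hz]; simp
        · rw [mul_comm]
          gcongr
          have hh := hhalf _ hpos
          -- A point of `G` that is not in `E` has already been stopped, so at least `n / 2 - n / 4`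
          -- points still collect the drift `d`.
          have hsub : (Finset.univ.filter fun i => y i ∈ G ⟨s, hs⟩) ⊆
              (Finset.univ.filter fun i => y i ∈ E) ∪
                (Finset.univ.filter fun i => M < |U T (y i)|) := by
            intro i hi
            simp only [Finset.mem_union, Finset.mem_filter, Finset.mem_univ, true_and] at hi ⊢
            by_cases hc : |U s (y i)| ≤ M
            · exact Or.inl ((hmem _).mpr ⟨hc, hi⟩)
            · exact Or.inr (lt_abs_stoppedSum_of_le hs.le (not_le.mp hc))
          have hcard : ((Finset.univ.filter fun i => y i ∈ G ⟨s, hs⟩).card : ℝ) ≤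
              (Finset.univ.filter fun i => y i ∈ E).card +
                (Finset.univ.filter fun i => M < |U T (y i)|).card := by
            exact_mod_cast (Finset.card_le_card hsub).trans (Finset.card_union_le _ _)
          linarith
      · have hstep : ∀ ω, U (s + 1) ω = U s ω := fun ω => by
          simp only [U]
          rw [stoppedSum, dif_neg hs, add_zero]
        simp_rw [hstep]
        rw [dif_neg hs, add_zero]
        exact ih
  have h1 := hlow T
  rw [← Finset.sum_fin_eq_sum_range d] at h1
  -- Stopping makes the sum a bounded test function of mean zero under the product law, so its data
  -- average is at most `η * (M + L)`.
  have h2 := (abs_le.mp (hy (U T) _ hUb)).2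
  rw [hmean, sub_zero, div_le_iff₀ hn'] at h2
  have h3 : (n : ℝ) * (∑ t, d t) ≤ n * (4 * (η * (M + L))) := by linarith
  exact le_of_mul_le_mul_left h3 hn'

end StoppedSum

/-! ### Cell means, medians and nested intervals -/

section CellMeans

open Classical in
/-- The average of `v` over the cell of `i`, that is, over the points with the same label. -/
noncomputable def cellMean {κ : Type*} {n : ℕ} (c : Fin n → κ) (v : Fin n → ℝ) (i : Fin n) : ℝ :=
  (∑ j ∈ Finset.univ.filter (fun j => c j = c i), v j) /
    (Finset.univ.filter fun j => c j = c i).card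

theorem cellMean_congr {κ : Type*} {n : ℕ} {c : Fin n → κ} (v : Fin n → ℝ) {i j : Fin n}
    (h : c i = c j) : cellMean c v i = cellMean c v j := by
  rw [cellMean, cellMean, h]

-- A set that is a union of cells does not notice averaging within cells. Predictable events are
-- such unions when the label is the past, so lower bounds on cell means become lower bounds on data
-- sums.
open Classical in
theorem sum_cellMean {κ : Type*} {n : ℕ} (c : Fin n → κ) (v : Fin n → ℝ) (p : Fin n → Prop)
    (hp : ∀ i j, c i = c j → (p i ↔ p j)) :
    ∑ i ∈ Finset.univ.filter p, cellMean c v i = ∑ i ∈ Finset.univ.filter p, v i := by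
  simp only [cellMean, Finset.sum_div]
  simp only [Finset.sum_filter]
  have : ∀ i, (if p i then ∑ j, (if c j = c i then
      v j / ((Finset.univ.filter fun j => c j = c i).card : ℝ) else 0) else 0)
      = ∑ j, if p j ∧ c i = c j then
        v j / ((Finset.univ.filter fun l => c l = c j).card : ℝ) else 0 := by
    intro i
    by_cases hi : p i
    · rw [if_pos hi]
      refine Finset.sum_congr rfl fun j _ => ?_
      by_cases hj : c j = c i
      · have : p j := (hp j i hj).mpr hi
        simp [hj, this]
      · have : ¬ c i = c j := fun h => hj h.symm
        simp [hj, this]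
    · rw [if_neg hi]
      refine (Finset.sum_eq_zero fun j _ => ?_).symm
      rw [if_neg]
      rintro ⟨h1, h2⟩
      exact hi ((hp i j h2).mpr h1)
  simp_rw [this]
  rw [Finset.sum_comm]
  refine Finset.sum_congr rfl fun j _ => ?_
  by_cases hj : p j
  · simp only [hj, true_and, if_true]
    rw [← Finset.sum_filter, Finset.sum_const, nsmul_eq_mul]
    have : ((Finset.univ.filter fun l => c l = c j).card : ℝ) ≠ 0 := by
      have : 0 < (Finset.univ.filter fun l => c l = c j).card :=
        Finset.card_pos.mpr ⟨j, by simp⟩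
      positivity
    field_simp
  · simp [hj]

/-- Take the least data value with at least half of the data at or below it. If more than half were
strictly below, their maximum would be a smaller such value. -/
theorem exists_median {n : ℕ} (u : Fin n → ℝ) :
    ∃ m : ℝ, (n : ℝ) / 2 ≤ (Finset.univ.filter fun i => m ≤ u i).card ∧
      (n : ℝ) / 2 ≤ (Finset.univ.filter fun i => u i ≤ m).card := by
  rcases Nat.eq_zero_or_pos n with rfl | hn
  · exact ⟨0, by simp, by simp⟩
  have : Nonempty (Fin n) := ⟨⟨0, hn⟩⟩
  let S := Finset.univ.filter fun i : Fin n => n ≤ 2 * (Finset.univ.filter fun l => u l ≤ u i).card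
  have hS : S.Nonempty := by
    obtain ⟨i, -, hi⟩ := Finset.exists_max_image Finset.univ u Finset.univ_nonempty
    refine ⟨i, ?_⟩
    have : (Finset.univ.filter fun l => u l ≤ u i) = Finset.univ :=
      Finset.filter_true_of_mem hi
    simp only [S, Finset.mem_filter, Finset.mem_univ, true_and, this, Finset.card_univ,
      Fintype.card_fin]
    omega
  obtain ⟨i, hiS, hi⟩ := Finset.exists_min_image S u hS
  refine ⟨u i, ?_, ?_⟩
  · have hlt : 2 * (Finset.univ.filter fun l => u l < u i).card ≤ n := by
      by_contra! hcon
      have hne : (Finset.univ.filter fun l => u l < u i).Nonempty := by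
        rw [← Finset.card_pos]; omega
      obtain ⟨j, hj, hjmax⟩ := Finset.exists_max_image _ u hne
      have hsub : (Finset.univ.filter fun l => u l < u i) ⊆
          Finset.univ.filter fun l => u l ≤ u j := fun l hl => by
        simpa using hjmax l hl
      have hjS : j ∈ S := by
        have := Finset.card_le_card hsub
        simp only [S, Finset.mem_filter, Finset.mem_univ, true_and]
        omega
      have := hi j hjS
      have h2 : u j < u i := by simpa using hj
      linarith
    have hc := Finset.card_filter_add_card_filter_not (s := (Finset.univ : Finset (Fin n)))
      (fun l => u l < u i)
    simp only [not_lt, Finset.card_univ, Fintype.card_fin] at hc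
    have : n ≤ 2 * (Finset.univ.filter fun l => u i ≤ u l).card := by omega
    have : (n : ℝ) ≤ 2 * (Finset.univ.filter fun l => u i ≤ u l).card := by exact_mod_cast this
    linarith
  · have : n ≤ 2 * (Finset.univ.filter fun l => u l ≤ u i).card := by
      simpa [S] using hiS
    have : (n : ℝ) ≤ 2 * (Finset.univ.filter fun l => u l ≤ u i).card := by exact_mod_cast this
    linarith

/-- A median of the values `u i`. -/
noncomputable def median {n : ℕ} (u : Fin n → ℝ) : ℝ := (exists_median u).choose

/-- Choose a point of the longest initial segment of intervals having a common point. It does not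
depend on `v`: wherever the unknown mean meets an initial segment, the chosen point does too. -/
theorem exists_mem_nested_intervals (c r : ℕ → ℝ) (J : ℕ) :
    ∃ x : ℝ, ∀ (v : ℝ) (J' : ℕ), J' ≤ J → (∀ j ≤ J', |v - c j| ≤ r j) →
      ∀ j ≤ J', |x - c j| ≤ r j := by
  induction J with
  | zero =>
    by_cases h : ∃ v, |v - c 0| ≤ r 0
    · obtain ⟨x, hx⟩ := h
      refine ⟨x, fun v J' hJ' _ j hj => ?_⟩
      obtain rfl : j = 0 := by omega
      exact hx
    · refine ⟨0, fun v J' _ hv => absurd ⟨v, hv 0 (Nat.zero_le _)⟩ h⟩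
  | succ J ih =>
    by_cases h : ∃ v, ∀ j ≤ J + 1, |v - c j| ≤ r j
    · obtain ⟨x, hx⟩ := h
      exact ⟨x, fun v J' hJ' _ j hj => hx j (hj.trans hJ')⟩
    · obtain ⟨x, hx⟩ := ih
      refine ⟨x, fun v J' hJ' hv => ?_⟩
      rcases Nat.lt_or_ge J J' with hlt | hle
      · obtain rfl : J' = J + 1 := by omega
        exact absurd ⟨v, hv⟩ h
      · exact hx v J' hle hv

end CellMeans

/-! ### The estimator on discrete readings -/

section RoundEstimate

/-- With the discrete σ-algebra on readings, the choices made by the estimator raise no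
measurability question. -/
instance : MeasurableSpace (Option ℤ) := ⊤

/-- The projection of `y` to `[-R, R]`. -/
noncomputable def clip (R y : ℝ) : ℝ := max (-R) (min R y)

theorem abs_clip_le {R : ℝ} (hR : 0 ≤ R) (y : ℝ) : |clip R y| ≤ R := by
  rw [clip, abs_le]
  exact ⟨le_max_left _ _, max_le (by linarith) (min_le_left _ _)⟩

/-- The offset of a reading from `a`, clipped to `[-R, R]`, where a masked reading counts as `0`
and an unmasked one is scaled by the inverse `N` of the probability of being unmasked. -/
noncomputable def score (N : ℝ) (a : ℤ) (R : ℝ) : Option ℤ → ℝ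
  | none => 0
  | some m => N * clip R (m - a)

theorem abs_score_le {N R : ℝ} (hN : 0 ≤ N) (hR : 0 ≤ R) (a : ℤ) (o : Option ℤ) :
    |score N a R o| ≤ N * R := by
  cases o with
  | none => simpa [score] using mul_nonneg hN hR
  | some m =>
    rw [score, abs_mul, abs_of_nonneg hN]
    exact mul_le_mul_of_nonneg_left (abs_clip_le hR _) hN

open Classical in
/-- The indicator of the unmasked readings within distance `r` of `a`. -/
noncomputable def nearIndicator (a r : ℝ) : Option ℤ → ℝ
  | none => 0
  | some m => if |(m : ℝ) - a| ≤ r then 1 else 0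

open Classical in
/-- The indicator of the unmasked readings at distance more than `r` from `a`. -/
noncomputable def farIndicator (a r : ℝ) : Option ℤ → ℝ
  | none => 0
  | some m => if r < |(m : ℝ) - a| then 1 else 0

theorem abs_nearIndicator_le (a r : ℝ) (o : Option ℤ) : |nearIndicator a r o| ≤ 1 := by
  cases o with
  | none => simp [nearIndicator]
  | some m => rw [nearIndicator]; split_ifs <;> simp

theorem abs_farIndicator_le (a r : ℝ) (o : Option ℤ) : |farIndicator a r o| ≤ 1 := by
  cases o with
  | none => simp [farIndicator]
  | some m => rw [farIndicator]; split_ifs <;> simp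

variable {n : ℕ}

open Classical in
/-- An integer near which many of the readings of a round lie. -/
noncomputable def roughCentre (N : ℝ) (col : Fin n → Option ℤ) : ℤ :=
  if h : ∃ a : ℤ, 3 / (5 * N) ≤ (∑ i, nearIndicator a 6 (col i)) / n then h.choose else 0

/-- The estimate of the mean reading from the scores at scale `j`: at scale `0` from the average
score, at the other scales from the median over the data of the cell means. -/
noncomputable def scaleCentre {κ : Type*} (N ρ : ℝ) (c : Fin n → κ) (col : Fin n → Option ℤ) :
    ℕ → ℝ
  | 0 => roughCentre N col + (∑ i, score N (roughCentre N col) ρ (col i)) / n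
  | j + 1 => roughCentre N col +
      median (cellMean c fun i => score N (roughCentre N col) (ρ * 2 ^ (j + 1)) (col i))

/-- A point of the longest possible initial segment of the confidence intervals around the
`scaleCentre`s, whose radii decrease geometrically from `D`. -/
noncomputable def roundEstimate {κ : Type*} (N ρ D : ℝ) (J : ℕ) (c : Fin n → κ)
    (col : Fin n → Option ℤ) : ℝ :=
  (exists_mem_nested_intervals (scaleCentre N ρ c col) (fun j => D / 2 ^ j) J).choose

/-- The label of a data point in round `t`: its readings before `t`. -/
def pastLabel {T : ℕ} (y : Fin n → Fin T → Option ℤ) (t : Fin T) (i : Fin n) :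
    Fin T → Option ℤ :=
  fun r => if r < t then y i r else none

theorem pastLabel_eq_iff {T : ℕ} (y : Fin n → Fin T → Option ℤ) (t : Fin T) (i j : Fin n) :
    pastLabel y t i = pastLabel y t j ↔ ∀ r < t, y i r = y j r := by
  constructor
  · intro h r hr
    have := congrFun h r
    simpa [pastLabel, hr] using this
  · intro h
    ext1 r
    by_cases hr : r < t
    · simp [pastLabel, hr, h r hr]
    · simp [pastLabel, hr]

/-- The estimate of round `t` from rounded and masked readings. -/
noncomputable def readingEstimate {T : ℕ} (N ρ D : ℝ) (y : Fin n → Fin T → Option ℤ)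
    (t : Fin T) : ℝ :=
  roundEstimate N ρ D T (pastLabel y t) fun i => y i t

theorem readingEstimate_congr {T : ℕ} (N ρ D : ℝ) {y z : Fin n → Fin T → Option ℤ} {t : Fin T}
    (h : ∀ i, ∀ r ≤ t, y i r = z i r) : readingEstimate N ρ D y t = readingEstimate N ρ D z t := by
  have h1 : pastLabel y t = pastLabel z t := by
    ext1 i
    ext1 r
    by_cases hr : r < t
    · simp [pastLabel, hr, h i r hr.le]
    · simp [pastLabel, hr]
  have h2 : (fun i => y i t) = fun i => z i t := funext fun i => h i t le_rfl
  rw [readingEstimate, readingEstimate, h1, h2]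

end RoundEstimate

/-! ### Deterministic analysis of the estimates -/

/-- The properties of the law of a rounded and masked reading that the estimator relies on: `m` is
the mean before masking, `1 / N` the probability of being unmasked, `G` bounds the moments, and
`ρ * 2 ^ j` are the clipping thresholds. -/
structure IsReadingLaw (N G ρ E : ℝ) (ν : Measure (Option ℤ)) (m : ℝ) : Prop where
  near : 3 / (4 * N) ≤ ∫ o, nearIndicator m 5 o ∂ν
  far : ∫ o, farIndicator m 5 o ∂ν ≤ 1 / (4 * N)
  bias : ∀ (a : ℤ) (j : ℕ), |(a : ℝ) - m| ≤ 12 →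
    |∫ o, score N a (ρ * 2 ^ j) o ∂ν - (m - a)| ≤ G * E / 2 ^ j
  variance : ∀ (a : ℤ) (R : ℝ), |(a : ℝ) - m| ≤ 12 → 0 < R →
    ∫ o, score N a R o ^ 2 ∂ν ≤ N * G

/-- Adding the squares one by one, the first partial sum above `1` overshoots by at most `1 / 4`.
The lower bound forces a large drift, while the upper bound caps the variance of the bets. -/
theorem exists_subset_sum_sq_between {ι : Type*} (s : Finset ι) (w : ι → ℝ)
    (hw : ∀ i, 0 ≤ w i) (hw2 : ∀ i, w i ≤ 1 / 2) (hs : 1 < ∑ i ∈ s, w i ^ 2) :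
    ∃ S ⊆ s, 1 < ∑ i ∈ S, w i ^ 2 ∧ ∑ i ∈ S, w i ^ 2 ≤ 2 := by
  classical
  induction s using Finset.induction_on with
  | empty => simp at hs; linarith
  | insert i s hi ih =>
    by_cases h : 1 < ∑ i ∈ s, w i ^ 2
    · obtain ⟨S, hS, h1⟩ := ih h
      exact ⟨S, hS.trans (Finset.subset_insert _ _), h1⟩
    · refine ⟨insert i s, subset_rfl, hs, ?_⟩
      rw [Finset.sum_insert hi]
      nlinarith [hw i, hw2 i]

section Analysis

variable {n T : ℕ} {N G ρ ε : ℝ} {ν : Fin T → Measure (Option ℤ)}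
  [∀ t, IsProbabilityMeasure (ν t)] {m : Fin T → ℝ} {y : Fin n → Fin T → Option ℤ}

theorem EmpiricallyClose.eval {P : Measure (Fin T → Option ℤ)} {η : ℝ}
    (hP : P = Measure.pi ν) (hy : EmpiricallyClose y P η) (t : Fin T) :
    EmpiricallyClose (fun i => y i t) (ν t) η := by
  intro g B hg
  have := hy (fun ω => g (ω t)) B fun ω => hg _
  rw [hP, integral_comp_eval (μ := ν) (i := t) (f := g)
    (Measurable.of_discrete).aestronglyMeasurable] at this
  exact this

/-- The floor of the mean qualifies as a centre, since `3/4 - 1/10 ≥ 3/5`. For any qualifying centre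
the readings near it outnumber those far from the mean, as `3/5 > 1/4 + 1/10`, so one reading is
within `6` of the centre and within `5` of the mean. -/
theorem abs_roughCentre_sub_le (hN : 0 < N) {m₀ : ℝ} {ν₀ : Measure (Option ℤ)}
    [IsProbabilityMeasure ν₀] (hnear : 3 / (4 * N) ≤ ∫ o, nearIndicator m₀ 5 o ∂ν₀)
    (hfar : ∫ o, farIndicator m₀ 5 o ∂ν₀ ≤ 1 / (4 * N))
    (hn : 0 < n) {col : Fin n → Option ℤ} {η : ℝ} (hcol : EmpiricallyClose col ν₀ η)
    (hη : η ≤ 1 / (10 * N)) : |(roughCentre N col : ℝ) - m₀| ≤ 11 := by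
  have hn' : (0 : ℝ) < n := by exact_mod_cast hn
  have h1 := (abs_le.mp (hcol _ 1 (abs_nearIndicator_le m₀ 5))).1
  have h2 := (abs_le.mp (hcol _ 1 (abs_farIndicator_le m₀ 5))).2
  have hNi : 0 < N⁻¹ := inv_pos.mpr hN
  have q1 : 3 / (4 * N) = 3 / 4 * N⁻¹ := by field_simp
  have q2 : 1 / (4 * N) = 1 / 4 * N⁻¹ := by field_simp
  have q3 : 1 / (10 * N) = 1 / 10 * N⁻¹ := by field_simp
  have q4 : 3 / (5 * N) = 3 / 5 * N⁻¹ := by field_simp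
  rw [q1] at hnear
  rw [q2] at hfar
  rw [q3] at hη
  have hex : ∃ a : ℤ, 3 / (5 * N) ≤ (∑ i, nearIndicator a 6 (col i)) / n := by
    refine ⟨⌊m₀⌋, ?_⟩
    have hle : (∑ i, nearIndicator m₀ 5 (col i)) / n
        ≤ (∑ i, nearIndicator (⌊m₀⌋ : ℤ) 6 (col i)) / n := by
      gcongr with i
      cases col i with
      | none => simp [nearIndicator]
      | some x =>
        simp only [nearIndicator]
        by_cases hx : |(x : ℝ) - m₀| ≤ 5
        · have := Int.floor_le m₀
          have := Int.lt_floor_add_one m₀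
          have h6 : |(x : ℝ) - (⌊m₀⌋ : ℤ)| ≤ 6 := by
            rw [abs_le] at hx ⊢
            constructor <;> linarith
          rw [if_pos hx, if_pos h6]
        · rw [if_neg hx]
          split_ifs <;> norm_num
    rw [q4]
    linarith
  rw [roughCentre, dif_pos hex]
  have ha := hex.choose_spec
  set a := hex.choose
  rw [q4] at ha
  have hlt : (∑ i, farIndicator m₀ 5 (col i)) / n < (∑ i, nearIndicator a 6 (col i)) / n := by
    linarith
  rw [div_lt_div_iff_of_pos_right hn'] at hlt
  obtain ⟨i, -, hi⟩ := Finset.exists_lt_of_sum_lt hlt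
  cases hc : col i with
  | none => simp [hc, farIndicator, nearIndicator] at hi
  | some x =>
    rw [hc] at hi
    simp only [farIndicator, nearIndicator] at hi
    by_cases h5 : 5 < |(x : ℝ) - m₀|
    · rw [if_pos h5] at hi
      split_ifs at hi <;> linarith
    · rw [if_neg h5] at hi
      by_cases h6 : |(x : ℝ) - a| ≤ 6
      · have := not_lt.mp h5
        rw [abs_le] at *
        constructor <;> linarith
      · rw [if_neg h6] at hi
        exact absurd hi (lt_irrefl _)

/-- The radius of the widest confidence interval, in units of the target error. -/
noncomputable def intervalConstant (N G : ℝ) : ℝ := G + 12 * (16 * N * G + 2 * N) + 1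

theorem abs_scaleCentre_zero_sub_le {κ : Type*} (hN : 1 ≤ N) (hG : 1 ≤ G) (hρ : 1 ≤ ρ)
    (hε : 0 < ε) {m₀ : ℝ} {ν₀ : Measure (Option ℤ)} (hν : IsReadingLaw N G ρ (ε * ρ) ν₀ m₀)
    {col : Fin n → Option ℤ} (hcol : EmpiricallyClose col ν₀ (3 * ε))
    (ha : |(roughCentre N col : ℝ) - m₀| ≤ 12) (c : Fin n → κ) :
    |m₀ - scaleCentre N ρ c col 0| ≤ intervalConstant N G * (ε * ρ) := by
  have h1 := hν.bias _ 0 ha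
  have h2 := hcol (score N (roughCentre N col) ρ) (N * ρ)
    (abs_score_le (by linarith) (by linarith) _)
  rw [pow_zero, mul_one, div_one] at h1
  rw [scaleCentre]
  have hE : 0 < ε * ρ := by positivity
  have hNG : 0 ≤ N * G := by positivity
  have h3 : G * (ε * ρ) + 3 * ε * (N * ρ) ≤ intervalConstant N G * (ε * ρ) := by
    rw [intervalConstant]
    nlinarith [mul_nonneg hNG hE.le]
  rw [abs_le] at *
  constructor <;> linarith

open Classical in
/-- The rounds in which an interval misses the mean have bounded total weight. -/
theorem sum_sq_weight_le_one (hn : 0 < n) (hN : 1 ≤ N) (hG : 1 ≤ G) (hρ : 1 ≤ ρ) (hε : 0 < ε)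
    (hε8 : 3 * ε ≤ 1 / 8) (hν : ∀ t, IsReadingLaw N G ρ (ε * ρ) (ν t) (m t))
    (hy : EmpiricallyClose y (Measure.pi ν) (3 * ε))
    (ha : ∀ t, |(roughCentre N (fun i => y i t) : ℝ) - m t| ≤ 12)
    (B : Finset (Fin T)) (jj : Fin T → ℕ)
    (hmiss : ∀ t ∈ B, intervalConstant N G * (ε * ρ) / 2 ^ (jj t + 1) <
      |m t - scaleCentre N ρ (pastLabel y t) (fun i => y i t) (jj t + 1)|) :
    ∑ t ∈ B, (1 / 2 ^ (jj t + 1) : ℝ) ^ 2 ≤ 1 := by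
  by_contra! hcon
  have hwle : ∀ t, (1 / 2 ^ (jj t + 1) : ℝ) ≤ 1 / 2 := fun t => by
    rw [pow_succ]
    have : (1 : ℝ) ≤ 2 ^ jj t := one_le_pow₀ (by norm_num)
    gcongr
    linarith
  -- Only the rounds of `S` are bet on.
  obtain ⟨S, hSB, hS1, hS2⟩ := exists_subset_sum_sq_between B
    (fun t => (1 / 2 ^ (jj t + 1) : ℝ)) (fun t => by positivity) hwle hcon
  set w : Fin T → ℝ := fun t => 1 / 2 ^ (jj t + 1) with hw
  have hw0 : ∀ t, 0 < w t := fun t => by positivity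
  set E := ε * ρ with hEdef
  have hE : 0 < E := by positivity
  set H := intervalConstant N G with hHdef
  let a : Fin T → ℤ := fun t => roughCentre N fun i => y i t
  let sc : Fin T → Option ℤ → ℝ := fun t => score N (a t) (ρ * 2 ^ (jj t + 1))
  let u : Fin T → Fin n → ℝ := fun t => cellMean (pastLabel y t) fun i => sc t (y i t)
  let e : Fin T → ℝ := fun t => ∫ o, sc t o ∂(ν t)
  have hbias : ∀ t, |e t - (m t - a t)| ≤ G * E * w t := fun t => by
    have := (hν t).bias (a t) (jj t + 1) (ha t)
    rwa [div_eq_mul_one_div] at this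
  have hscale : ∀ t, scaleCentre N ρ (pastLabel y t) (fun i => y i t) (jj t + 1)
      = a t + median (u t) := fun t => rfl
  -- The sign `σ` is the direction of the miss. The median lies beyond `m` by `H E w`, and the
  -- clipping bias uses up `G E w`; half of the cell means lie at least as far out as the median.
  have hmed : ∀ t, ∃ σ θ : ℝ, |σ| = 1 ∧
      (n : ℝ) / 2 ≤ (Finset.univ.filter fun i => θ ≤ σ * u t i).card ∧
      (t ∈ S → (H - G) * E * w t ≤ θ - σ * e t) := by
    intro t
    obtain ⟨h1, h2⟩ := (exists_median (u t)).choose_spec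
    change (n : ℝ) / 2 ≤ (Finset.univ.filter fun i => median (u t) ≤ u t i).card at h1
    change (n : ℝ) / 2 ≤ (Finset.univ.filter fun i => u t i ≤ median (u t)).card at h2
    have hb := abs_le.mp (hbias t)
    rcases le_total (m t) (a t + median (u t)) with hle | hle
    · refine ⟨1, median (u t), abs_one, by simpa using h1, fun ht => ?_⟩
      have h3 := hmiss t (hSB ht)
      rw [hscale, abs_of_nonpos (by linarith), div_eq_mul_one_div] at h3
      change H * E * w t < _ at h3
      linarith [hb.2]
    · refine ⟨-1, -median (u t), by simp, by simpa using h2, fun ht => ?_⟩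
      have h3 := hmiss t (hSB ht)
      rw [hscale, abs_of_nonneg (by linarith), div_eq_mul_one_div] at h3
      change H * E * w t < _ at h3
      linarith [hb.1]
  choose σ θ hσ hcard hgap using hmed
  have hσ2 : ∀ t, σ t ^ 2 = 1 := fun t => by rw [← sq_abs, hσ]; norm_num
  have hsc : ∀ t o, |sc t o| ≤ N * (ρ * 2 ^ (jj t + 1)) := fun t o =>
    abs_score_le (by linarith) (by positivity) _ _
  have hsci : ∀ t, Integrable (sc t) (ν t) := fun t => integrable_of_forall_abs_le _ (hsc t)
  have he : ∀ t, |e t| ≤ N * (ρ * 2 ^ (jj t + 1)) := fun t => by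
    have := norm_integral_le_of_norm_le_const (μ := ν t) (f := sc t)
      (Filter.Eventually.of_forall (hsc t))
    simpa using this
  -- The factor `w` cancels `2 ^ (jj t + 1)` in the clipping threshold, so all bets share the bound
  -- `2 * N * ρ`.
  let h : Fin T → Option ℤ → ℝ := fun t o => if t ∈ S then w t * σ t * (sc t o - e t) else 0
  -- The pasts whose cell mean is beyond `θ`: a cell mean depends on a data point only through its
  -- past, so the event is predictable.
  let Gs : Fin T → Set (Fin T → Option ℤ) := fun t =>
    {ω | ∃ i, (∀ r < t, ω r = y i r) ∧ θ t ≤ σ t * u t i}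
  let d : Fin T → ℝ := fun t => if t ∈ S then (H - G) * E * w t ^ 2 else 0
  have hHG : 0 < H - G := by
    rw [hHdef, intervalConstant]
    have : 0 ≤ N * G := by positivity
    linarith
  have hGs : ∀ t, IsPredictableAt t (Gs t) := by
    intro t ω ω' hω
    constructor
    · rintro ⟨i, hi, hθ⟩
      exact ⟨i, fun r hr => (hω r hr).symm.trans (hi r hr), hθ⟩
    · rintro ⟨i, hi, hθ⟩
      exact ⟨i, fun r hr => (hω r hr).trans (hi r hr), hθ⟩
  have hmem : ∀ t i, y i ∈ Gs t ↔ θ t ≤ σ t * u t i := by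
    intro t i
    constructor
    · rintro ⟨l, hl, hθ⟩
      have : u t i = u t l := cellMean_congr _ ((pastLabel_eq_iff y t i l).mpr hl)
      rwa [this]
    · intro hθ
      exact ⟨i, fun _ _ => rfl, hθ⟩
  have hNρ : 0 < N * ρ := by positivity
  have hL : ∀ t o, |h t o| ≤ 2 * N * ρ := by
    intro t o
    simp only [h]
    split_ifs
    · rw [abs_mul, abs_mul, hσ, mul_one, abs_of_pos (hw0 t)]
      have h1 : |sc t o - e t| ≤ 2 * (N * (ρ * 2 ^ (jj t + 1))) :=
        (abs_sub _ _).trans (by linarith [hsc t o, he t])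
      calc w t * |sc t o - e t| ≤ w t * (2 * (N * (ρ * 2 ^ (jj t + 1)))) := by
            have := (hw0 t).le
            gcongr
        _ = 2 * N * ρ := by
            simp only [hw]
            field_simp
    · rw [abs_zero]; linarith
  have h0 : ∀ t, ∫ o, h t o ∂(ν t) = 0 := by
    intro t
    simp only [h]
    split_ifs
    · rw [integral_const_mul, integral_sub (hsci t) (integrable_const _)]
      simp [e]
    · simp
  have hvar : ∀ t, ∫ o, h t o ^ 2 ∂(ν t) ≤ if t ∈ S then N * G * w t ^ 2 else 0 := by
    intro t
    simp only [h]
    split_ifs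
    · have hsc2 : Integrable (fun o => sc t o ^ 2) (ν t) :=
        integrable_of_forall_abs_le _ (B := (N * (ρ * 2 ^ (jj t + 1))) ^ 2) fun o => by
          rw [abs_pow]; exact pow_le_pow_left₀ (abs_nonneg _) (hsc t o) 2
      have hexp : ∀ o, (w t * σ t * (sc t o - e t)) ^ 2
          = w t ^ 2 * (sc t o ^ 2 - 2 * e t * sc t o + e t ^ 2) := fun o => by
        linear_combination (w t ^ 2 * (sc t o - e t) ^ 2) * hσ2 t
      simp_rw [hexp]
      have i1 : Integrable (fun o => sc t o ^ 2 - 2 * e t * sc t o) (ν t) :=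
        hsc2.sub ((hsci t).const_mul _)
      rw [integral_const_mul, integral_add i1 (integrable_const _),
        integral_sub hsc2 ((hsci t).const_mul _), integral_const_mul]
      have hv := (hν t).variance (a t) (ρ * 2 ^ (jj t + 1)) (ha t) (by positivity)
      change ∫ o, sc t o ^ 2 ∂(ν t) ≤ _ at hv
      change w t ^ 2 * (_ - 2 * e t * e t + _) ≤ _
      simp only [integral_const, probReal_univ, one_smul]
      rw [mul_comm (N * G)]
      gcongr
      nlinarith [sq_nonneg (e t)]
    · simp
  have hV : ∑ t, ∫ o, h t o ^ 2 ∂(ν t) ≤ 2 * N * G := by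
    refine (Finset.sum_le_sum fun t _ => hvar t).trans ?_
    rw [Finset.sum_ite_mem, Finset.univ_inter, ← Finset.mul_sum]
    have hNG : 0 < N * G := by positivity
    nlinarith
  have hNG1 : 1 ≤ N * G := by nlinarith
  -- The stopping level `16 N G ρ` makes the Chebyshev term at most `1 / 8`; the corruption term
  -- takes the other `1 / 8`.
  have hVM : 2 * N * G / (16 * N * G * ρ) ^ 2 + 3 * ε ≤ 1 / 4 := by
    have : 2 * N * G / (16 * N * G * ρ) ^ 2 ≤ 1 / 8 := by
      rw [div_le_div_iff₀ (by positivity) (by norm_num)]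
      have h1 : 1 ≤ ρ ^ 2 := one_le_pow₀ hρ
      have h2 : N * G ≤ (N * G) ^ 2 := by nlinarith
      have h3 : (N * G) ^ 2 ≤ (N * G) ^ 2 * ρ ^ 2 := le_mul_of_one_le_right (by positivity) h1
      nlinarith
    linarith
  have hd : ∀ t, 0 ≤ d t := fun t => by
    simp only [d]
    split_ifs <;> positivity
  have hdrift : ∀ t F, IsPredictableAt t F → F ⊆ Gs t →
      d t * (Finset.univ.filter fun i => y i ∈ F).card
        ≤ ∑ i ∈ Finset.univ.filter (fun i => y i ∈ F), h t (y i t) := by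
    intro t F hF hFG
    simp only [h, d]
    split_ifs with ht
    · rw [← Finset.mul_sum, Finset.sum_sub_distrib, ← sum_cellMean (pastLabel y t) _
        (fun i => y i ∈ F) fun i l hil => hF _ _ ((pastLabel_eq_iff y t i l).mp hil),
        ← Finset.sum_sub_distrib, Finset.mul_sum, mul_comm, ← nsmul_eq_mul, ← Finset.sum_const]
      refine Finset.sum_le_sum fun i hi => ?_
      have hiF : y i ∈ F := by simpa using hi
      have h1 := (hmem t i).mp (hFG hiF)
      have h2 := hgap t ht
      change _ ≤ w t * σ t * (u t i - e t)
      rw [mul_assoc (w t)]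
      have h3 : (H - G) * E * w t ≤ σ t * (u t i - e t) := by linarith
      calc (H - G) * E * w t ^ 2 = w t * ((H - G) * E * w t) := by ring
        _ ≤ _ := mul_le_mul_of_nonneg_left h3 (hw0 t).le
    · simp
  have hfin := sum_drift_le ν hn hy (M := 16 * N * G * ρ) (L := 2 * N * ρ) (by positivity)
    (by positivity) hL hGs h0 hV hVM hd (fun t _ => by simpa only [hmem] using hcard t) hdrift
  simp only [d] at hfin
  rw [Finset.sum_ite_mem, Finset.univ_inter, ← Finset.mul_sum] at hfin
  have h1 : (H - G) * E ≤ (H - G) * E * ∑ t ∈ S, w t ^ 2 :=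
    le_mul_of_one_le_right (by positivity) hS1.le
  -- The drift bound equals `(H - G - 1) * E`, whereas the drift is at least `(H - G) * E`; the
  -- summand `1` in `intervalConstant` gives the contradiction.
  have h2 : 4 * (3 * ε * (16 * N * G * ρ + 2 * N * ρ)) = (H - G - 1) * E := by
    rw [hHdef, intervalConstant, hEdef]
    ring
  linarith

/-- Scale `0` never misses. Rounds with a miss contribute at most `16 D²` in total by the weight
bound, the others at most `4 D²`, and `20 ≤ 5²`. -/
theorem sum_sq_readingEstimate_sub_le (hn : 0 < n) (hN : 1 ≤ N) (hG : 1 ≤ G) (hρ : 1 ≤ ρ)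
    (hε : 0 < ε) (hε8 : 3 * ε ≤ 1 / 8) (hεN : 3 * ε ≤ 1 / (10 * N))
    (hν : ∀ t, IsReadingLaw N G ρ (ε * ρ) (ν t) (m t))
    (hy : EmpiricallyClose y (Measure.pi ν) (3 * ε)) :
    ∑ t, (readingEstimate N ρ (intervalConstant N G * (ε * ρ)) y t - m t) ^ 2
      ≤ (5 * intervalConstant N G * (ε * ρ)) ^ 2 := by
  classical
  set D := intervalConstant N G * (ε * ρ) with hD
  have hD0 : 0 < D := by
    have : 0 ≤ N * G := by positivity
    have : 0 < intervalConstant N G := by rw [intervalConstant]; linarith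
    positivity
  have ha : ∀ t, |(roughCentre N (fun i => y i t) : ℝ) - m t| ≤ 12 := fun t =>
    (abs_roughCentre_sub_le (by linarith) (hν t).near (hν t).far hn (hy.eval rfl t) hεN).trans
      (by norm_num)
  let c : Fin T → ℕ → ℝ := fun t => scaleCentre N ρ (pastLabel y t) fun i => y i t
  have hc0 : ∀ t, |m t - c t 0| ≤ D / 2 ^ 0 := fun t => by
    rw [pow_zero, div_one]
    exact abs_scaleCentre_zero_sub_le hN hG hρ hε (hν t) (hy.eval rfl t) (ha t) _
  let est := readingEstimate N ρ D y
  have hest : ∀ t J, J ≤ T → (∀ j ≤ J, |m t - c t j| ≤ D / 2 ^ j) →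
      |est t - m t| ≤ 2 * D / 2 ^ J := by
    intro t J hJ hj
    have h1 := (exists_mem_nested_intervals (c t) (fun j => D / 2 ^ j) T).choose_spec
      (m t) J hJ hj J le_rfl
    have h2 := hj J le_rfl
    have h3 : est t = (exists_mem_nested_intervals (c t) (fun j => D / 2 ^ j) T).choose := rfl
    rw [← h3] at h1
    have h4 : 2 * D / 2 ^ J = D / 2 ^ J + D / 2 ^ J := by ring
    rw [abs_le] at h1 h2 ⊢
    constructor <;> linarith
  let B : Finset (Fin T) := Finset.univ.filter fun t => ∃ j, j < T ∧ D / 2 ^ (j + 1) < |m t - c t (j + 1)|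
  -- The first missed scale is `jj t + 1`. Mean and estimate both lie in the interval of radius `D /
  -- 2 ^ jj t`, so they differ by at most `2 D / 2 ^ jj t = 4 D / 2 ^ (jj t + 1)`.
  have hfirst : ∀ t, ∃ j : ℕ, t ∈ B → (D / 2 ^ (j + 1) < |m t - c t (j + 1)| ∧
      |est t - m t| ≤ 4 * D * (1 / 2 ^ (j + 1))) := by
    intro t
    by_cases ht : t ∈ B
    · have hex : ∃ j, j < T ∧ D / 2 ^ (j + 1) < |m t - c t (j + 1)| := by simpa [B] using ht
      refine ⟨Nat.find hex, fun _ => ⟨(Nat.find_spec hex).2, ?_⟩⟩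
      have hlt := (Nat.find_spec hex).1
      refine (hest t (Nat.find hex) hlt.le fun j hj => ?_).trans (le_of_eq ?_)
      · rcases j with _ | j
        · exact hc0 t
        · have := Nat.find_min hex (m := j) (by omega)
          push Not at this
          exact this (by omega)
      · rw [pow_succ]
        field_simp
        norm_num
    · exact ⟨0, fun h => absurd h ht⟩
  choose jj hjj using hfirst
  have hw := sum_sq_weight_le_one hn hN hG hρ hε hε8 hν hy ha B jj fun t ht => (hjj t ht).1
  have hterm : ∀ t, (est t - m t) ^ 2 ≤
      (if t ∈ B then 16 * D ^ 2 * (1 / 2 ^ (jj t + 1) : ℝ) ^ 2 else 0) + 4 * D ^ 2 * (1 / 2 ^ T) := by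
    intro t
    by_cases ht : t ∈ B
    · rw [if_pos ht, ← sq_abs]
      have h1 := pow_le_pow_left₀ (abs_nonneg _) (hjj t ht).2 2
      have h2 : 0 ≤ 4 * D ^ 2 * (1 / 2 ^ T) := by positivity
      calc |est t - m t| ^ 2 ≤ (4 * D * (1 / 2 ^ (jj t + 1))) ^ 2 := h1
        _ = 16 * D ^ 2 * (1 / 2 ^ (jj t + 1) : ℝ) ^ 2 := by ring
        _ ≤ _ := by linarith
    · rw [if_neg ht, zero_add, ← sq_abs]
      have h1 : |est t - m t| ≤ 2 * D / 2 ^ T := by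
        refine hest t T le_rfl fun j hj => ?_
        rcases j with _ | j
        · exact hc0 t
        · by_contra! hlt
          exact ht (by simp only [B, Finset.mem_filter, Finset.mem_univ, true_and]; exact ⟨j, by omega, hlt⟩)
      calc |est t - m t| ^ 2 ≤ (2 * D / 2 ^ T) ^ 2 := pow_le_pow_left₀ (abs_nonneg _) h1 2
        _ = 4 * D ^ 2 * (1 / 2 ^ T * (1 / 2 ^ T)) := by ring
        _ ≤ 4 * D ^ 2 * (1 / 2 ^ T * 1) := by
            gcongr
            rw [div_le_one (by positivity)]
            exact one_le_pow₀ (by norm_num)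
        _ = _ := by rw [mul_one]
  -- Going up to scale `T` makes the residual errors of all `T` rounds summable to a constant
  -- multiple of `D²`.
  have hT : (T : ℝ) * (1 / 2 ^ T) ≤ 1 := by
    rw [mul_one_div, div_le_one (by positivity)]
    exact_mod_cast Nat.lt_two_pow_self.le
  calc ∑ t, (est t - m t) ^ 2 ≤ ∑ t, ((if t ∈ B then 16 * D ^ 2 * (1 / 2 ^ (jj t + 1) : ℝ) ^ 2 else 0)
        + 4 * D ^ 2 * (1 / 2 ^ T)) := Finset.sum_le_sum fun t _ => hterm t
    _ = 16 * D ^ 2 * (∑ t ∈ B, (1 / 2 ^ (jj t + 1) : ℝ) ^ 2) + 4 * D ^ 2 * (T * (1 / 2 ^ T)) := by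
        rw [Finset.sum_add_distrib, Finset.sum_ite_mem, Finset.univ_inter, ← Finset.mul_sum]
        simp only [Finset.sum_const, Finset.card_univ, Fintype.card_fin, nsmul_eq_mul]
        ring
    _ ≤ 16 * D ^ 2 * 1 + 4 * D ^ 2 * 1 := by gcongr
    _ ≤ (5 * intervalConstant N G * (ε * ρ)) ^ 2 := by
        rw [show 5 * intervalConstant N G * (ε * ρ) = 5 * D by rw [hD]; ring]
        nlinarith [sq_nonneg D]

end Analysis

/-! ### Random rounding and masking -/

/-- The uniform distribution on `[0, 1)`. -/
noncomputable def unitLaw : Measure ℝ := volume.restrict (Set.Ico 0 1)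

instance : IsProbabilityMeasure unitLaw := ⟨by simp [unitLaw]⟩

/-- The distribution on `Bool` with probability `1 / N` of `true`. -/
noncomputable def maskLaw (N : ℝ) : Measure Bool :=
  ENNReal.ofReal (1 - 1 / N) • Measure.dirac false + ENNReal.ofReal (1 / N) • Measure.dirac true

theorem isProbabilityMeasure_maskLaw {N : ℝ} (hN : 1 ≤ N) : IsProbabilityMeasure (maskLaw N) := by
  have h : 1 / N ≤ 1 := (div_le_one (by linarith)).mpr hN
  refine ⟨?_⟩
  simp only [maskLaw, Measure.coe_add, Measure.coe_smul, Pi.add_apply, Pi.smul_apply,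
    measure_univ, smul_eq_mul, mul_one]
  rw [← ENNReal.ofReal_add (by linarith) (by positivity)]
  simp

/-- The random rounding of `x` to an integer that has mean `x`, masked if `s.2` is `false`. -/
noncomputable def reading (p : ℝ × ℝ × Bool) : Option ℤ :=
  if p.2.2 then some ⌊p.1 + p.2.1⌋ else none

theorem measurable_reading : Measurable reading := by
  refine Measurable.ite ?_ ?_ measurable_const
  · exact (measurable_snd.comp measurable_snd) (MeasurableSet.of_discrete (s := {true}))
  · exact (Measurable.of_discrete (f := fun z : ℤ => some z)).comp
      (Int.measurable_floor.comp (measurable_fst.add (measurable_fst.comp measurable_snd)))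

/-- The law of the rounded and masked reading of a draw from `D`. -/
noncomputable def readingLaw (N : ℝ) (D : Measure ℝ) : Measure (Option ℤ) :=
  (D.prod (unitLaw.prod (maskLaw N))).map reading

theorem isProbabilityMeasure_readingLaw {N : ℝ} (hN : 1 ≤ N) (D : Measure ℝ)
    [IsProbabilityMeasure D] : IsProbabilityMeasure (readingLaw N D) := by
  have := isProbabilityMeasure_maskLaw hN
  exact Measure.isProbabilityMeasure_map measurable_reading.aemeasurable

/-- The rounding of `p.1` by the shift `p.2`. -/
noncomputable def shiftFloor (p : ℝ × ℝ) : ℤ := ⌊p.1 + p.2⌋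

theorem measurable_shiftFloor : Measurable shiftFloor :=
  Int.measurable_floor.comp (measurable_fst.add measurable_snd)

theorem measurable_some_shiftFloor : Measurable fun p => some (shiftFloor p) :=
  (Measurable.of_discrete (f := fun z : ℤ => some z)).comp measurable_shiftFloor

theorem measurable_shiftFloor_cast : Measurable fun p => (shiftFloor p : ℝ) :=
  (Measurable.of_discrete (f := fun z : ℤ => (z : ℝ))).comp measurable_shiftFloor

theorem readingLaw_eq (N : ℝ) (D : Measure ℝ) [IsProbabilityMeasure D] :
    readingLaw N D = ENNReal.ofReal (1 - 1 / N) • Measure.dirac none +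
      ENNReal.ofReal (1 / N) • ((D.prod unitLaw).map fun p => some (shiftFloor p)) := by
  have hpart : ∀ b : Bool, (D.prod (unitLaw.prod (Measure.dirac b))).map reading
      = (D.prod unitLaw).map fun p => reading (p.1, p.2, b) := by
    intro b
    rw [Measure.prod_dirac]
    nth_rewrite 1 [← Measure.map_id (μ := D)]
    rw [Measure.map_prod_map _ _ measurable_id (by fun_prop),
      Measure.map_map measurable_reading (by fun_prop)]
    rfl
  have hfin : ∀ (c : ENNReal) (b : Bool), c ≠ ⊤ → IsFiniteMeasure (c • Measure.dirac b) :=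
    fun c b hc => Measure.smul_finite _ hc
  have := hfin (ENNReal.ofReal (1 - 1 / N)) false ENNReal.ofReal_ne_top
  have := hfin (ENNReal.ofReal (1 / N)) true ENNReal.ofReal_ne_top
  rw [readingLaw, maskLaw, Measure.prod_add, Measure.prod_smul_right, Measure.prod_smul_right,
    Measure.prod_add, Measure.prod_smul_right, Measure.prod_smul_right,
    Measure.map_add _ _ measurable_reading, Measure.map_smul, Measure.map_smul, hpart, hpart]
  congr 2
  have : (fun p : ℝ × ℝ => reading (p.1, p.2, false)) = fun _ => none := rfl
  rw [this, Measure.map_const]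
  simp

theorem integrable_readingLaw {N : ℝ} (D : Measure ℝ) [IsProbabilityMeasure D]
    {φ : Option ℤ → ℝ} (hφ : Integrable (fun p => φ (some (shiftFloor p))) (D.prod unitLaw)) :
    Integrable φ (readingLaw N D) := by
  rw [readingLaw_eq]
  refine Integrable.add_measure ?_ ?_
  · exact (integrable_dirac (by simp)).smul_measure ENNReal.ofReal_ne_top
  · refine Integrable.smul_measure ?_ ENNReal.ofReal_ne_top
    rw [integrable_map_measure (Measurable.of_discrete).aestronglyMeasurable
      measurable_some_shiftFloor.aemeasurable]
    exact hφ

theorem integral_readingLaw {N : ℝ} (hN : 1 ≤ N) (D : Measure ℝ) [IsProbabilityMeasure D]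
    {φ : Option ℤ → ℝ} (hφ : Integrable (fun p => φ (some (shiftFloor p))) (D.prod unitLaw)) :
    ∫ o, φ o ∂(readingLaw N D) =
      (1 - 1 / N) * φ none + 1 / N * ∫ p, φ (some (shiftFloor p)) ∂(D.prod unitLaw) := by
  have h : 1 / N ≤ 1 := (div_le_one (by linarith)).mpr hN
  have hi := integrable_readingLaw (N := N) D hφ
  rw [readingLaw_eq] at hi ⊢
  rw [integral_add_measure hi.left_of_add_measure hi.right_of_add_measure, integral_smul_measure,
    integral_smul_measure, integral_dirac, integral_map
      measurable_some_shiftFloor.aemeasurable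
      (Measurable.of_discrete).aestronglyMeasurable,
    ENNReal.toReal_ofReal (by linarith), ENNReal.toReal_ofReal (by positivity)]
  rfl

/-- By periodicity the fractional part of `x + u` has average `1 / 2`, exactly the mean of `u`. -/
theorem integral_floor_add (x : ℝ) : ∫ u, (⌊x + u⌋ : ℝ) ∂unitLaw = x := by
  have hfl : ∀ u : ℝ, (⌊x + u⌋ : ℝ) = x + u - Int.fract (x + u) := fun u => by
    rw [Int.self_sub_fract]
  have hfr : IntervalIntegrable Int.fract volume 0 1 := by
    rw [intervalIntegrable_iff_integrableOn_Ioc_of_le zero_le_one]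
    exact Integrable.of_bound measurable_fract.aestronglyMeasurable 1
      (Filter.Eventually.of_forall fun u => by
        rw [Real.norm_eq_abs, abs_of_nonneg (Int.fract_nonneg u)]
        exact (Int.fract_lt_one u).le)
  have hfx : IntervalIntegrable (fun u => Int.fract (x + u)) volume 0 1 := by
    rw [intervalIntegrable_iff_integrableOn_Ioc_of_le zero_le_one]
    exact Integrable.of_bound (measurable_fract.comp (measurable_const_add x)).aestronglyMeasurable 1
      (Filter.Eventually.of_forall fun u => by
        rw [Real.norm_eq_abs, abs_of_nonneg (Int.fract_nonneg _)]
        exact (Int.fract_lt_one _).le)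
  have hper : Function.Periodic (Int.fract : ℝ → ℝ) 1 := fun u => Int.fract_add_one u
  have h1 : ∫ u in (0 : ℝ)..1, Int.fract (x + u) = ∫ u in (0 : ℝ)..1, Int.fract u := by
    rw [intervalIntegral.integral_comp_add_left (fun u => Int.fract u) x, add_zero]
    have := hper.intervalIntegral_add_eq x 0
    rwa [zero_add] at this
  have h2 : ∫ u in (0 : ℝ)..1, Int.fract u = 1 / 2 := by
    have : ∫ u in (0 : ℝ)..1, Int.fract u = ∫ u in (0 : ℝ)..1, u := by
      rw [intervalIntegral.integral_of_le zero_le_one, intervalIntegral.integral_of_le zero_le_one,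
        ← integral_Ico_eq_integral_Ioc, ← integral_Ico_eq_integral_Ioc]
      refine setIntegral_congr_fun measurableSet_Ico fun u hu => ?_
      exact Int.fract_eq_self.mpr hu
    rw [this, integral_id]
    norm_num
  rw [unitLaw, integral_Ico_eq_integral_Ioc, ← intervalIntegral.integral_of_le zero_le_one]
  simp_rw [hfl]
  rw [intervalIntegral.integral_sub (Continuous.intervalIntegrable (by fun_prop) _ _) hfx, h1, h2,
    intervalIntegral.integral_add (Continuous.intervalIntegrable (by fun_prop) _ _)
      (Continuous.intervalIntegrable (by fun_prop) _ _), integral_id]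
  simp

theorem sq_le_one_add_abs_pow {k : ℕ} (hk : 2 ≤ k) (y : ℝ) : y ^ 2 ≤ 1 + |y| ^ k := by
  rw [← sq_abs]
  rcases le_total |y| 1 with h | h
  · have := pow_le_one₀ (n := 2) (abs_nonneg y) h
    have : 0 ≤ |y| ^ k := by positivity
    linarith
  · have := pow_le_pow_right₀ h hk
    linarith

/-- Clipping acts only when `|y| > R`, and then moves `y` by at most `|y| ≤ |y| * (|y| / R) ^ (k -
1)`. -/
theorem abs_clip_sub_le {k : ℕ} (hk : 1 ≤ k) {R : ℝ} (hR : 0 < R) (y : ℝ) :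
    |clip R y - y| ≤ |y| ^ k / R ^ (k - 1) := by
  rcases le_or_gt |y| R with h | h
  · have : clip R y = y := by
      rw [abs_le] at h
      rw [clip, min_eq_right h.2, max_eq_right h.1]
    rw [this, sub_self, abs_zero]
    positivity
  · have h1 : |clip R y - y| ≤ |y| := by
      rw [clip]
      rcases lt_abs.mp h with h2 | h2
      · rw [min_eq_left h2.le, max_eq_right (by linarith), abs_of_nonpos (by linarith),
          abs_of_pos (by linarith)]
        linarith
      · rw [min_eq_right (by linarith), max_eq_left (by linarith), abs_of_nonneg (by linarith),
          abs_of_neg (by linarith)]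
        linarith
    refine h1.trans ?_
    rw [le_div_iff₀ (by positivity)]
    calc |y| * R ^ (k - 1) ≤ |y| * |y| ^ (k - 1) := by gcongr
      _ = |y| ^ k := by rw [← pow_succ', Nat.sub_add_cancel hk]

/-- The bound on the `k`-th moments of the rounded readings around integers close to the mean. -/
noncomputable def momentConstant (k : ℕ) : ℝ := 1 + 2 ^ (k - 1) * (1 + 13 ^ k)

/-! ### Moments of the readings -/

section Moments

variable {k : ℕ} {D : Measure ℝ} [IsProbabilityMeasure D]

theorem ae_abs_shiftFloor_sub_le (D : Measure ℝ) [IsProbabilityMeasure D] :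
    ∀ᵐ p ∂(D.prod unitLaw), |(shiftFloor p : ℝ) - p.1| ≤ 1 := by
  have h : ∀ᵐ u ∂unitLaw, u ∈ Set.Ico (0 : ℝ) 1 := ae_restrict_mem measurableSet_Ico
  have h2 := (Measure.quasiMeasurePreserving_snd (μ := D) (ν := unitLaw)).ae h
  filter_upwards [h2] with p hp
  have h3 := Int.floor_le (p.1 + p.2)
  have h4 := Int.lt_floor_add_one (p.1 + p.2)
  rw [shiftFloor, abs_le]
  constructor <;> linarith [hp.1, hp.2]

theorem integrable_abs_sub_pow (hD : CentralMomentLeOne k D) :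
    Integrable (fun p : ℝ × ℝ => |p.1 - ∫ y, y ∂D| ^ k) (D.prod unitLaw) := by
  have h1 : MemLp (fun x : ℝ => x - ∫ y, y ∂D) k D := hD.1.sub (memLp_const _)
  exact (h1.integrable_norm_pow').comp_fst unitLaw

theorem integral_abs_sub_pow_le (hD : CentralMomentLeOne k D) :
    ∫ p : ℝ × ℝ, |p.1 - ∫ y, y ∂D| ^ k ∂(D.prod unitLaw) ≤ 1 := by
  rw [integral_fun_fst (fun x => |x - ∫ y, y ∂D| ^ k)]
  simpa using hD.2

theorem integrable_pow_of_ae_abs_le (hD : CentralMomentLeOne k D) {g : ℝ × ℝ → ℝ}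
    (hg : Measurable g) {b : ℝ} (hb : 0 ≤ b)
    (h : ∀ᵐ p ∂(D.prod unitLaw), |g p| ≤ |p.1 - ∫ y, y ∂D| + b) :
    Integrable (fun p => |g p| ^ k) (D.prod unitLaw) ∧
      ∫ p, |g p| ^ k ∂(D.prod unitLaw) ≤ 2 ^ (k - 1) * (1 + b ^ k) := by
  have hle : ∀ᵐ p ∂(D.prod unitLaw), |g p| ^ k
      ≤ 2 ^ (k - 1) * (|p.1 - ∫ y, y ∂D| ^ k + b ^ k) := by
    filter_upwards [h] with p hp
    exact (pow_le_pow_left₀ (abs_nonneg _) hp k).trans (add_pow_le (abs_nonneg _) hb k)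
  have hi : Integrable (fun p : ℝ × ℝ => 2 ^ (k - 1) * (|p.1 - ∫ y, y ∂D| ^ k + b ^ k))
      (D.prod unitLaw) := ((integrable_abs_sub_pow hD).add (integrable_const _)).const_mul _
  have hgi : Integrable (fun p => |g p| ^ k) (D.prod unitLaw) := by
    refine hi.mono' (by fun_prop) ?_
    filter_upwards [hle] with p hp
    rwa [Real.norm_eq_abs, abs_of_nonneg (by positivity)]
  refine ⟨hgi, (integral_mono_ae hgi hi hle).trans ?_⟩
  rw [integral_const_mul, integral_add (integrable_abs_sub_pow hD) (integrable_const _)]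
  have := integral_abs_sub_pow_le hD
  simp only [integral_const, probReal_univ, one_smul]
  gcongr

theorem integrable_sq_shiftFloor_sub (hk : 2 ≤ k) (hD : CentralMomentLeOne k D) (a : ℝ) :
    Integrable (fun p => ((shiftFloor p : ℝ) - a) ^ 2) (D.prod unitLaw) := by
  have hm : Measurable fun p : ℝ × ℝ => (shiftFloor p : ℝ) - a :=
    measurable_shiftFloor_cast.sub_const a
  have h := integrable_pow_of_ae_abs_le hD hm (b := 1 + |(∫ y, y ∂D) - a|) (by positivity) (by
    filter_upwards [ae_abs_shiftFloor_sub_le D] with p hp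
    calc |(shiftFloor p : ℝ) - a|
        = |((shiftFloor p : ℝ) - p.1) + (p.1 - ∫ y, y ∂D) + ((∫ y, y ∂D) - a)| := by congr 1; ring
      _ ≤ |(shiftFloor p : ℝ) - p.1| + |p.1 - ∫ y, y ∂D| + |(∫ y, y ∂D) - a| := abs_add_three _ _ _
      _ ≤ _ := by linarith)
  refine ((integrable_const (1 : ℝ)).add h.1).mono' (hm.pow_const 2).aestronglyMeasurable
    (Filter.Eventually.of_forall fun p => ?_)
  rw [Real.norm_eq_abs, abs_of_nonneg (sq_nonneg _)]
  exact sq_le_one_add_abs_pow hk _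

/-- Rounding moves a draw by at most `1`, so the square is at most `2 + 2 (1 + |x - μ|^k)`, whose
mean is at most `6`. At distance `5` Chebyshev then gives `6 / 25 ≤ 1 / 4`. -/
theorem integral_sq_shiftFloor_sub_mean_le (hk : 2 ≤ k) (hD : CentralMomentLeOne k D) :
    ∫ p, ((shiftFloor p : ℝ) - ∫ y, y ∂D) ^ 2 ∂(D.prod unitLaw) ≤ 6 := by
  have hi : Integrable (fun p : ℝ × ℝ => 4 + 2 * |p.1 - ∫ y, y ∂D| ^ k) (D.prod unitLaw) :=
    (integrable_const _).add ((integrable_abs_sub_pow hD).const_mul _)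
  refine (integral_mono_ae (integrable_sq_shiftFloor_sub hk hD _) hi ?_).trans ?_
  · filter_upwards [ae_abs_shiftFloor_sub_le D] with p hp
    have h1 := sq_le_one_add_abs_pow hk (p.1 - ∫ y, y ∂D)
    have h2 : ((shiftFloor p : ℝ) - p.1) ^ 2 ≤ 1 := by
      rw [← sq_abs]; exact pow_le_one₀ (abs_nonneg _) hp
    nlinarith [sq_nonneg (((shiftFloor p : ℝ) - p.1) - (p.1 - ∫ y, y ∂D))]
  · rw [integral_add (integrable_const _) ((integrable_abs_sub_pow hD).const_mul _),
      integral_const_mul]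
    have := integral_abs_sub_pow_le hD
    simp only [integral_const, probReal_univ, one_smul]
    linarith

theorem integral_shiftFloor (hk : 2 ≤ k) (hD : CentralMomentLeOne k D) :
    Integrable (fun p => (shiftFloor p : ℝ)) (D.prod unitLaw) ∧
      ∫ p, (shiftFloor p : ℝ) ∂(D.prod unitLaw) = ∫ y, y ∂D := by
  have hi : Integrable (fun p => (shiftFloor p : ℝ)) (D.prod unitLaw) := by
    refine ((integrable_const (1 : ℝ)).add (integrable_sq_shiftFloor_sub hk hD 0)).mono'
      measurable_shiftFloor_cast.aestronglyMeasurable (Filter.Eventually.of_forall fun p => ?_)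
    simp only [Pi.add_apply, sub_zero, Real.norm_eq_abs]
    rw [← sq_abs]
    nlinarith [sq_nonneg (|(shiftFloor p : ℝ)| - 1), abs_nonneg (shiftFloor p : ℝ)]
  refine ⟨hi, ?_⟩
  rw [integral_prod _ hi]
  simp only [shiftFloor, integral_floor_add]

theorem isReadingLaw_readingLaw (hk : 2 ≤ k) (hD : CentralMomentLeOne k D) {N ρ ε : ℝ}
    (hN : 1 ≤ N) (hρ : 0 < ρ) (hρε : ε * ρ ^ k = 1) :
    IsReadingLaw N (momentConstant k) ρ (ε * ρ) (readingLaw N D) (∫ y, y ∂D) := by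
  have hN0 : 0 < N := by linarith
  set μ := ∫ y, y ∂D with hμ
  have bint : ∀ (φ : Option ℤ → ℝ) (B : ℝ), (∀ o, |φ o| ≤ B) →
      Integrable (fun p => φ (some (shiftFloor p))) (D.prod unitLaw) := fun φ B hB =>
    Integrable.of_bound ((Measurable.of_discrete (f := fun z : ℤ => φ (some z))).comp
      measurable_shiftFloor).aestronglyMeasurable B (Filter.Eventually.of_forall fun p => hB _)
  have hfar : ∫ p, farIndicator μ 5 (some (shiftFloor p)) ∂(D.prod unitLaw) ≤ 1 / 4 := by
    have hsq := integrable_sq_shiftFloor_sub hk hD μ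
    calc _ ≤ ∫ p, ((shiftFloor p : ℝ) - μ) ^ 2 / 25 ∂(D.prod unitLaw) := by
          refine integral_mono (bint _ 1 (abs_farIndicator_le μ 5)) (hsq.div_const _) fun p => ?_
          simp only [farIndicator]
          split_ifs with h
          · rw [le_div_iff₀ (by norm_num), ← sq_abs]
            nlinarith
          · positivity
      _ = (∫ p, ((shiftFloor p : ℝ) - μ) ^ 2 ∂(D.prod unitLaw)) / 25 := integral_div _ _
      _ ≤ 6 / 25 := by
          gcongr
          exact integral_sq_shiftFloor_sub_mean_le hk hD
      _ ≤ 1 / 4 := by norm_num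
  -- The `13` is the distance `12` of the centre plus the rounding error `1`.
  have hshift : ∀ a : ℤ, |(a : ℝ) - μ| ≤ 12 → ∀ᵐ p ∂(D.prod unitLaw),
      |(shiftFloor p : ℝ) - a| ≤ |p.1 - μ| + 13 := by
    intro a ha
    filter_upwards [ae_abs_shiftFloor_sub_le D] with p hp
    rw [abs_sub_comm] at ha
    calc |(shiftFloor p : ℝ) - a|
        = |((shiftFloor p : ℝ) - p.1) + (p.1 - μ) + (μ - a)| := by congr 1; ring
      _ ≤ |(shiftFloor p : ℝ) - p.1| + |p.1 - μ| + |μ - a| := abs_add_three _ _ _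
      _ ≤ _ := by linarith
  have hmom : ∀ a : ℤ, |(a : ℝ) - μ| ≤ 12 → _ := fun a ha =>
    integrable_pow_of_ae_abs_le hD (measurable_shiftFloor_cast.sub_const (a : ℝ)) (b := 13) (by norm_num) (hshift a ha)
  refine ⟨?_, ?_, ?_, ?_⟩
  · rw [integral_readingLaw hN D (bint _ 1 (abs_nearIndicator_le μ 5))]
    have hsum : ∀ p : ℝ × ℝ, nearIndicator μ 5 (some (shiftFloor p))
        = 1 - farIndicator μ 5 (some (shiftFloor p)) := fun p => by
      simp only [nearIndicator, farIndicator]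
      by_cases h : |(shiftFloor p : ℝ) - μ| ≤ 5
      · rw [if_pos h, if_neg (not_lt.mpr h), sub_zero]
      · rw [if_neg h, if_pos (not_le.mp h), sub_self]
    simp_rw [hsum]
    rw [integral_sub (integrable_const _) (bint _ 1 (abs_farIndicator_le μ 5))]
    simp only [nearIndicator, mul_zero, zero_add, integral_const, probReal_univ, one_smul]
    calc 3 / (4 * N) = 1 / N * (1 - 1 / 4) := by field_simp; norm_num
      _ ≤ _ := by gcongr
  · rw [integral_readingLaw hN D (bint _ 1 (abs_farIndicator_le μ 5))]
    simp only [farIndicator, mul_zero, zero_add] at hfar ⊢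
    calc _ ≤ 1 / N * (1 / 4) := by gcongr
      _ = 1 / (4 * N) := by field_simp
  · intro a j ha
    have hR : 0 < ρ * 2 ^ j := by positivity
    set R := ρ * 2 ^ j with hRdef
    obtain ⟨hi, hI⟩ := hmom a ha
    obtain ⟨hfi, hfI⟩ := integral_shiftFloor hk hD
    have hs := bint (score N a R) _ (abs_score_le hN0.le hR.le a)
    rw [integral_readingLaw hN D hs]
    simp only [score] at hs ⊢
    rw [integral_const_mul]
    have hclip : Integrable (fun p => clip R ((shiftFloor p : ℝ) - a)) (D.prod unitLaw) :=
      bint (fun o => o.elim 0 fun z => clip R (z - a)) R fun o => by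
        cases o with
        | none => simpa using hR.le
        | some z => exact abs_clip_le hR.le _
    have hdiff : (1 - 1 / N) * 0 + 1 / N * (N * ∫ p, clip R ((shiftFloor p : ℝ) - a) ∂(D.prod unitLaw))
        - (μ - a) = ∫ p, (clip R ((shiftFloor p : ℝ) - a) - ((shiftFloor p : ℝ) - a)) ∂(D.prod unitLaw) := by
      have hfia : Integrable (fun p => (shiftFloor p : ℝ) - a) (D.prod unitLaw) :=
        hfi.sub (integrable_const _)
      rw [integral_sub hclip hfia, integral_sub hfi (integrable_const _),
        hfI]
      simp only [integral_const, probReal_univ, one_smul]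
      field_simp
      ring
    rw [hdiff, ← Real.norm_eq_abs]
    have hk1 : 1 ≤ k := by omega
    have hk0 : k - 1 ≠ 0 := by omega
    calc ‖∫ p, (clip R ((shiftFloor p : ℝ) - a) - ((shiftFloor p : ℝ) - a)) ∂(D.prod unitLaw)‖
        ≤ ∫ p, |(shiftFloor p : ℝ) - a| ^ k / R ^ (k - 1) ∂(D.prod unitLaw) :=
          norm_integral_le_of_norm_le (hi.div_const _) (Filter.Eventually.of_forall fun p =>
            abs_clip_sub_le hk1 hR _)
      _ = (∫ p, |(shiftFloor p : ℝ) - a| ^ k ∂(D.prod unitLaw)) / R ^ (k - 1) := integral_div _ _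
      _ ≤ momentConstant k / R ^ (k - 1) := by
          gcongr
          rw [momentConstant]
          linarith
      -- The relation `ε * ρ ^ k = 1` turns `1 / ρ ^ (k - 1)` into `ε * ρ`, and `2 ^ (j * (k - 1)) ≥
      -- 2 ^ j`.
      _ ≤ momentConstant k * (ε * ρ) / 2 ^ j := by
          have hG : 0 ≤ momentConstant k := by rw [momentConstant]; positivity
          rw [mul_div_assoc, div_eq_mul_one_div]
          refine mul_le_mul_of_nonneg_left ?_ hG
          rw [hRdef, mul_pow, div_le_div_iff₀ (by positivity) (by positivity)]
          have h1 : ρ * ρ ^ (k - 1) = ρ ^ k := by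
            rw [← pow_succ', Nat.sub_add_cancel hk1]
          have h2 : (2 : ℝ) ^ j ≤ (2 ^ j) ^ (k - 1) :=
            le_self_pow₀ (one_le_pow₀ (by norm_num)) hk0
          calc 1 * 2 ^ j ≤ 1 * (2 ^ j) ^ (k - 1) := by gcongr
            _ = ε * (ρ * ρ ^ (k - 1)) * (2 ^ j) ^ (k - 1) := by rw [h1, hρε]
            _ = _ := by ring
  · intro a R ha hR
    have hs2 : Integrable (fun p => score N a R (some (shiftFloor p)) ^ 2) (D.prod unitLaw) :=
      bint (fun o => score N a R o ^ 2) ((N * R) ^ 2) fun o => by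
        rw [abs_pow]; exact pow_le_pow_left₀ (abs_nonneg _) (abs_score_le hN0.le hR.le a o) 2
    rw [integral_readingLaw hN D (φ := fun o => score N a R o ^ 2) hs2]
    obtain ⟨hi, hI⟩ := hmom a ha
    have hb : ∫ p, score N a R (some (shiftFloor p)) ^ 2 ∂(D.prod unitLaw)
        ≤ N ^ 2 * momentConstant k := by
      calc _ ≤ ∫ p, N ^ 2 * (1 + |(shiftFloor p : ℝ) - a| ^ k) ∂(D.prod unitLaw) := by
            refine integral_mono hs2 (((integrable_const _).add hi).const_mul _) fun p => ?_
            simp only [score, mul_pow]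
            gcongr
            refine le_trans ?_ (sq_le_one_add_abs_pow hk _)
            rw [sq_le_sq, clip, abs_le]
            rcases le_total 0 ((shiftFloor p : ℝ) - a) with h | h
            · rw [abs_of_nonneg h]
              exact ⟨by linarith [le_max_right (-R) (min R ((shiftFloor p : ℝ) - a)),
                  le_min hR.le h], max_le (by linarith) (min_le_right _ _)⟩
            · rw [abs_of_nonpos h, neg_neg]
              exact ⟨le_max_of_le_right (le_min (by linarith) le_rfl),
                max_le (by linarith) ((min_le_right _ _).trans (by linarith))⟩
        _ = N ^ 2 * (1 + ∫ p, |(shiftFloor p : ℝ) - a| ^ k ∂(D.prod unitLaw)) := by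
            rw [integral_const_mul, integral_add (integrable_const _) hi]
            simp
        _ ≤ N ^ 2 * momentConstant k := by
            rw [momentConstant]
            gcongr
    calc _ ≤ (1 - 1 / N) * 0 + 1 / N * (N ^ 2 * momentConstant k) := by
          refine add_le_add (le_of_eq ?_) (by gcongr)
          simp [score]
      _ = N * momentConstant k := by field_simp; ring

end Moments

/-! ### The reference law and the factor `2` per round -/

section Reference

theorem summable_one_div_one_add_sq : Summable fun x : ℤ => 1 / (1 + (x : ℝ) ^ 2) := by
  have h1 : Summable fun x : ℤ => 1 / (x : ℝ) ^ 2 :=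
    Real.summable_one_div_int_pow.mpr one_lt_two
  have h2 : Summable fun x : ℤ => if x = 0 then (1 : ℝ) else 0 := (hasSum_ite_eq 0 1).summable
  refine Summable.of_nonneg_of_le (fun x => by positivity) (fun x => ?_) (h1.add h2)
  by_cases hx : x = 0
  · simp [hx]
  · have : (x : ℝ) ≠ 0 := by exact_mod_cast hx
    rw [if_neg hx, add_zero]
    gcongr
    linarith

/-- The normalizing constant of the weights `1 / (1 + x ^ 2)` on the integers. -/
noncomputable def latticeConstant : ℝ := ∑' x : ℤ, 1 / (1 + (x : ℝ) ^ 2)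

theorem latticeConstant_pos : 0 < latticeConstant :=
  summable_one_div_one_add_sq.tsum_pos (fun x => by positivity) 0 (by norm_num)

/-- The mass of `x` in the reference distribution centred at `c`. -/
noncomputable def referenceWeight (c x : ℤ) : ℝ :=
  1 / (4 * latticeConstant) * (1 / (1 + ((x : ℝ) - c) ^ 2))

theorem referenceWeight_pos (c x : ℤ) : 0 < referenceWeight c x := by
  have := latticeConstant_pos
  rw [referenceWeight]
  positivity

theorem hasSum_referenceWeight (c : ℤ) : HasSum (referenceWeight c) (1 / 4) := by
  have h := ((Equiv.subRight c).hasSum_iff.mpr summable_one_div_one_add_sq.hasSum).mul_left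
    (1 / (4 * latticeConstant))
  have h0 := latticeConstant_pos.ne'
  have e1 : (1 : ℝ) / 4 = 1 / (4 * latticeConstant) * latticeConstant := by field_simp
  have e2 : referenceWeight c = fun x => 1 / (4 * latticeConstant) *
      ((fun x : ℤ => 1 / (1 + (x : ℝ) ^ 2)) ∘ Equiv.subRight c) x := by
    ext x
    simp [referenceWeight]
  rw [e1, e2]
  exact h

/-- A distribution of full support against which the readings are compared: mass `3 / 4` at the
masked reading and a discrete Cauchy law around `c` on the unmasked ones. -/
noncomputable def referenceLaw (c : ℤ) : Measure (Option ℤ) :=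
  ENNReal.ofReal (3 / 4) • Measure.dirac none +
    Measure.sum fun x : ℤ => ENNReal.ofReal (referenceWeight c x) • Measure.dirac (some x)

instance (c : ℤ) : IsProbabilityMeasure (referenceLaw c) := by
  refine ⟨?_⟩
  have h := hasSum_referenceWeight c
  have h2 : ∑' x, ENNReal.ofReal (referenceWeight c x) = ENNReal.ofReal (1 / 4) := by
    rw [← ENNReal.ofReal_tsum_of_nonneg (fun x => (referenceWeight_pos c x).le) h.summable, h.tsum_eq]
  simp only [referenceLaw, Measure.coe_add, Measure.coe_smul, Pi.add_apply, Pi.smul_apply,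
    measure_univ, smul_eq_mul, mul_one, Measure.sum_apply _ MeasurableSet.univ]
  rw [h2, ← ENNReal.ofReal_add (by norm_num) (by norm_num)]
  norm_num

theorem referenceLaw_real_none (c : ℤ) : (referenceLaw c).real {none} = 3 / 4 := by
  rw [measureReal_def]
  simp only [referenceLaw, Measure.coe_add, Measure.coe_smul, Pi.add_apply, Pi.smul_apply,
    smul_eq_mul, Measure.sum_apply _ (MeasurableSet.of_discrete (s := ({none} : Set (Option ℤ))))]
  simp [show (0 : ℝ) ≤ 3 / 4 by norm_num]

theorem referenceLaw_real_some (c x : ℤ) :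
    (referenceLaw c).real {some x} = referenceWeight c x := by
  rw [measureReal_def]
  simp only [referenceLaw, Measure.coe_add, Measure.coe_smul, Pi.add_apply, Pi.smul_apply,
    smul_eq_mul, Measure.sum_apply _ (MeasurableSet.of_discrete (s := ({some x} : Set (Option ℤ))))]
  rw [tsum_eq_single x]
  · simp [(referenceWeight_pos c x).le]
  · intro z hz
    simp [hz]

theorem referenceLaw_real_pos (c : ℤ) (o : Option ℤ) : 0 < (referenceLaw c).real {o} := by
  cases o with
  | none => rw [referenceLaw_real_none]; norm_num
  | some x => rw [referenceLaw_real_some]; exact referenceWeight_pos c x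

/-- The inverse of the unmasking probability. -/
noncomputable def maskFactor : ℝ := 90 * latticeConstant + 1

theorem one_le_maskFactor : 1 ≤ maskFactor := by
  rw [maskFactor]
  linarith [latticeConstant_pos]

/-- The masked reading contributes at most `4 / 3`. On unmasked readings `1 / Q` grows only
quadratically, so finite variance suffices, and the rarity of unmasking brings their share down to
`2 / 3`. -/
theorem integral_inv_referenceLaw_le {k : ℕ} {D : Measure ℝ} [IsProbabilityMeasure D] (hk : 2 ≤ k)
    (hD : CentralMomentLeOne k D) :
    Integrable (fun o => ((referenceLaw ⌊∫ y, y ∂D⌋).real {o})⁻¹) (readingLaw maskFactor D) ∧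
      ∫ o, ((referenceLaw ⌊∫ y, y ∂D⌋).real {o})⁻¹ ∂(readingLaw maskFactor D) ≤ 2 := by
  set m := ∫ y, y ∂D
  set c := ⌊m⌋
  have hσ := latticeConstant_pos
  have hsq := integrable_sq_shiftFloor_sub hk hD (c : ℝ)
  have hsqm := integrable_sq_shiftFloor_sub hk hD m
  have hinv : ∀ p : ℝ × ℝ, ((referenceLaw c).real {some (shiftFloor p)})⁻¹
      = 4 * latticeConstant * (1 + ((shiftFloor p : ℝ) - c) ^ 2) := fun p => by
    rw [referenceLaw_real_some, referenceWeight]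
    field_simp
  have hi : Integrable (fun p : ℝ × ℝ => ((referenceLaw c).real {some (shiftFloor p)})⁻¹)
      (D.prod unitLaw) := by
    simp_rw [hinv]
    exact ((integrable_const _).add hsq).const_mul _
  refine ⟨integrable_readingLaw D (φ := fun o => ((referenceLaw c).real {o})⁻¹) hi, ?_⟩
  rw [integral_readingLaw one_le_maskFactor D (φ := fun o => ((referenceLaw c).real {o})⁻¹) hi]
  simp_rw [hinv]
  rw [integral_const_mul, integral_add (integrable_const _) hsq, referenceLaw_real_none]
  have h14 : ∫ p, ((shiftFloor p : ℝ) - c) ^ 2 ∂(D.prod unitLaw) ≤ 14 := by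
    calc _ ≤ ∫ p, (2 * ((shiftFloor p : ℝ) - m) ^ 2 + 2) ∂(D.prod unitLaw) := by
          refine integral_mono hsq ((hsqm.const_mul _).add (integrable_const _)) fun p => ?_
          have h1 := Int.floor_le m
          have h2 := Int.lt_floor_add_one m
          change (c : ℝ) ≤ m at h1
          change m < (c : ℝ) + 1 at h2
          have h3 : (m - c) ^ 2 ≤ 1 := by nlinarith
          simp only
          nlinarith [sq_nonneg (((shiftFloor p : ℝ) - m) - (m - c))]
      _ = 2 * (∫ p, ((shiftFloor p : ℝ) - m) ^ 2 ∂(D.prod unitLaw)) + 2 := by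
          rw [integral_add (hsqm.const_mul _) (integrable_const _), integral_const_mul]
          simp
      _ ≤ 14 := by linarith [integral_sq_shiftFloor_sub_mean_le hk hD]
  have hM : 0 < maskFactor := by linarith [one_le_maskFactor]
  simp only [integral_const, probReal_univ, one_smul]
  -- The second moment about `c` is at most `2 * 6 + 2 = 14`, so `4 * 15 = 60` must be at most `2 /
  -- 3` of the coefficient `90` in `maskFactor`.
  have hb : 1 / maskFactor * (4 * latticeConstant *
      (1 + ∫ p, ((shiftFloor p : ℝ) - c) ^ 2 ∂(D.prod unitLaw))) ≤ 2 / 3 := by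
    calc _ ≤ 1 / maskFactor * (4 * latticeConstant * (1 + 14)) := by gcongr
      _ ≤ 2 / 3 := by
          rw [one_div_mul_eq_div, div_le_iff₀ hM, maskFactor]
          linarith
  have : 0 < 1 / maskFactor := by positivity
  have h43 : (1 - 1 / maskFactor) * ((3 : ℝ) / 4)⁻¹ ≤ 4 / 3 := by
    rw [inv_div]
    linarith
  linarith

end Reference

theorem map_prod_pi_pi {ι α β γ : Type*} [Fintype ι] [MeasurableSpace α] [MeasurableSpace β]
    [MeasurableSpace γ] (μ : ι → Measure α) (ν : ι → Measure β) [∀ i, IsProbabilityMeasure (μ i)]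
    [∀ i, IsProbabilityMeasure (ν i)] {f : α × β → γ} (hf : Measurable f) :
    ((Measure.pi μ).prod (Measure.pi ν)).map (fun p i => f (p.1 i, p.2 i))
      = Measure.pi fun i => ((μ i).prod (ν i)).map f := by
  have : ∀ i, IsProbabilityMeasure (((μ i).prod (ν i)).map f) := fun i =>
    Measure.isProbabilityMeasure_map hf.aemeasurable
  rw [← (measurePreserving_arrowProdEquivProdArrow α β ι μ ν).map_eq,
    Measure.map_map (by fun_prop) (MeasurableEquiv.measurable _),
    ← Measure.pi_map_pi fun i => hf.aemeasurable]
  rfl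

/-! ### The estimator and its guarantee -/

section Estimator

variable {n T : ℕ}

/-- The rounded and masked readings of the data `x` with internal randomness `s`. -/
noncomputable def readings (s : Fin n → Fin T → ℝ × Bool) (x : Samples n T) :
    Fin n → Fin T → Option ℤ :=
  fun i r => reading (x i r, s i r)

theorem measurable_readings :
    Measurable fun p : (Fin n → Fin T → ℝ × Bool) × Samples n T => readings p.1 p.2 := by
  refine measurable_pi_lambda _ fun i => measurable_pi_lambda _ fun r => ?_
  refine measurable_reading.comp (Measurable.prodMk ?_ ?_) <;> fun_prop

/-- The law of the internal randomness used for one coordinate of one data point. -/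
noncomputable def coordinateSeedLaw : Measure (ℝ × Bool) := unitLaw.prod (maskLaw maskFactor)

instance : IsProbabilityMeasure coordinateSeedLaw := by
  have := isProbabilityMeasure_maskLaw one_le_maskFactor
  unfold coordinateSeedLaw
  infer_instance

/-- The estimator that rounds and masks the data and applies `readingEstimate`. -/
noncomputable def readingEstimator (n T : ℕ) (ρ D : ℝ) : OnlineEstimator n T where
  Seed := Fin n → Fin T → ℝ × Bool
  seedLaw := Measure.pi fun _ => Measure.pi fun _ => coordinateSeedLaw
  estimate s x t := readingEstimate maskFactor ρ D (readings s x) t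
  measurable_estimate :=
    (Measurable.of_discrete (f := fun z : Fin n → Fin T → Option ℤ =>
      fun t => readingEstimate maskFactor ρ D z t)).comp measurable_readings
  causal s x y t h := readingEstimate_congr _ _ _ fun i r hr => by
    simp only [readings, h i r hr]

/-- Sampling costs `ε * B`; each of at most `ε * n` replaced points changes the sum by at most `2 *
B`. -/
theorem EmpiricallyClose.of_corrupted {Ω : Type*} [MeasurableSpace Ω] [Countable Ω]
    [DiscreteMeasurableSpace Ω] {P : Measure Ω} [IsProbabilityMeasure P] (hn : 0 < n) {ε : ℝ}
    {z z' : Fin n → Ω} (hz : empiricalDeviation P z ≤ ε)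
    (hz' : ({i | z i ≠ z' i}.ncard : ℝ) ≤ ε * n) : EmpiricallyClose z' P (3 * ε) := by
  classical
  intro g B hg
  have hn' : (0 : ℝ) < n := by exact_mod_cast hn
  have hB : 0 ≤ B := (abs_nonneg _).trans (hg (z ⟨0, hn⟩))
  have h1 := abs_average_sub_integral_le P hn z hg
  have h2 : |(∑ i, g (z' i)) / n - (∑ i, g (z i)) / n| ≤ 2 * B * ε := by
    rw [← sub_div, ← Finset.sum_sub_distrib, abs_div, abs_of_pos hn', div_le_iff₀ hn']
    have hset : {i | z i ≠ z' i}.ncard = (Finset.univ.filter fun i => z i ≠ z' i).card := by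
      rw [← Set.ncard_coe_finset]
      congr 1
      ext i
      simp
    rw [hset] at hz'
    calc |∑ i, (g (z' i) - g (z i))| ≤ ∑ i, |g (z' i) - g (z i)| := Finset.abs_sum_le_sum_abs _ _
      _ ≤ ∑ i, if z i ≠ z' i then 2 * B else 0 := by
          refine Finset.sum_le_sum fun i _ => ?_
          split_ifs with h
          · exact (abs_sub _ _).trans (by linarith [hg (z i), hg (z' i)])
          · rw [not_not] at h
            rw [h, sub_self, abs_zero]
      _ = 2 * B * (Finset.univ.filter fun i => z i ≠ z' i).card := by
          rw [← Finset.sum_filter, Finset.sum_const, nsmul_eq_mul, mul_comm]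
      _ ≤ 2 * B * (ε * n) := by gcongr
      _ = 2 * B * ε * n := by ring
  have h3 : B * empiricalDeviation P z ≤ B * ε := by gcongr
  calc |(∑ i, g (z' i)) / n - ∫ ω, g ω ∂P|
      ≤ |(∑ i, g (z' i)) / n - (∑ i, g (z i)) / n| + |(∑ i, g (z i)) / n - ∫ ω, g ω ∂P| :=
        abs_sub_le _ _ _
    _ ≤ 3 * ε * B := by linarith

/-- The seed is independent of the clean data, so the clean readings are i.i.d. from the product of
the reading laws, whatever the adversary does. -/
theorem map_readings {D : Fin T → Measure ℝ} [∀ t, IsProbabilityMeasure (D t)]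
    {κ : Measure (Samples n T × Samples n T)} [IsProbabilityMeasure κ]
    (hκ : κ.map Prod.fst = Measure.pi fun _ : Fin n => Measure.pi D) :
    (κ.prod (Measure.pi fun _ : Fin n => Measure.pi fun _ : Fin T => coordinateSeedLaw)).map
        (fun q => readings q.2 q.1.1)
      = Measure.pi fun _ : Fin n => Measure.pi fun t => readingLaw maskFactor (D t) := by
  set S : Measure (Fin n → Fin T → ℝ × Bool) :=
    Measure.pi fun _ : Fin n => Measure.pi fun _ : Fin T => coordinateSeedLaw
  have h1 : (κ.prod S).map (fun q => readings q.2 q.1.1)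
      = ((κ.prod S).map (Prod.map Prod.fst id)).map (fun p => readings p.2 p.1) := by
    have hr : Measurable fun p : Samples n T × (Fin n → Fin T → ℝ × Bool) => readings p.2 p.1 :=
      measurable_readings.comp measurable_swap
    rw [Measure.map_map hr (by fun_prop)]
    rfl
  rw [h1, ← Measure.map_prod_map _ _ measurable_fst measurable_id, hκ, Measure.map_id]
  have hrow : Measurable fun p : (Fin T → ℝ) × (Fin T → ℝ × Bool) =>
      fun r => reading (p.1 r, p.2 r) := by
    refine measurable_pi_lambda _ fun r => ?_
    refine measurable_reading.comp (Measurable.prodMk ?_ ?_) <;> fun_prop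
  refine (map_prod_pi_pi (fun _ : Fin n => Measure.pi D)
    (fun _ => Measure.pi fun _ : Fin T => coordinateSeedLaw) hrow).trans ?_
  congr 1
  ext1 i
  exact map_prod_pi_pi D (fun _ => coordinateSeedLaw) measurable_reading

theorem ofReal_one_sub_le_empiricalDeviation_readingLaw {k : ℕ} (hk : 2 ≤ k)
    {D : Fin T → Measure ℝ} [∀ t, IsProbabilityMeasure (D t)]
    (hD : ∀ t, CentralMomentLeOne k (D t)) {ε τ : ℝ} (hε : 0 < ε) (hτ : 0 < τ) (hτ1 : τ < 1)
    (hn : 64 * 2 ^ T / ε ^ 2 * Real.log (2 / τ) ≤ n) :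
    ENNReal.ofReal (1 - τ) ≤
      (Measure.pi fun _ : Fin n => Measure.pi fun t => readingLaw maskFactor (D t))
        {z | empiricalDeviation (Measure.pi fun t => readingLaw maskFactor (D t)) z ≤ ε} := by
  have := fun t => isProbabilityMeasure_readingLaw one_le_maskFactor (D t)
  let Q : Fin T → Measure (Option ℤ) := fun t => referenceLaw ⌊∫ y, y ∂(D t)⌋
  have hQ : ∀ ω : Fin T → Option ℤ, (Measure.pi Q).real {ω} = ∏ t, (Q t).real {ω t} := fun ω => by
    simp [measureReal_def]
  have hinv : ∀ ω : Fin T → Option ℤ, ((Measure.pi Q).real {ω})⁻¹ = ∏ t, ((Q t).real {ω t})⁻¹ :=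
    fun ω => by rw [hQ, Finset.prod_inv_distrib]
  have href := fun t => integral_inv_referenceLaw_le hk (hD t)
  refine ofReal_one_sub_le_empiricalDeviation_le _ (Measure.pi Q) (fun ω => ?_) ?_ ?_
    (one_le_pow₀ (by norm_num)) hε hτ hτ1 hn
  · rw [hQ]
    exact Finset.prod_pos fun t _ => referenceLaw_real_pos _ _
  · simp_rw [hinv]
    exact Integrable.fintype_prod (f := fun t o => ((Q t).real {o})⁻¹) fun t => (href t).1
  · simp_rw [hinv]
    rw [integral_fintype_prod_eq_prod (fun t o => ((Q t).real {o})⁻¹)]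
    calc ∏ t, ∫ o, ((Q t).real {o})⁻¹ ∂(readingLaw maskFactor (D t)) ≤ ∏ _t : Fin T, (2 : ℝ) :=
          Finset.prod_le_prod (fun t _ => integral_nonneg fun o => by positivity)
            fun t _ => (href t).2
      _ = 2 ^ T := by simp

theorem estimatesMean_readingEstimator {k : ℕ} (hk : 2 ≤ k) {D : Fin T → Measure ℝ}
    [∀ t, IsProbabilityMeasure (D t)] (hD : ∀ t, CentralMomentLeOne k (D t)) {ε ρ τ : ℝ}
    (hε : 0 < ε) (hε8 : 3 * ε ≤ 1 / 8) (hεN : 3 * ε ≤ 1 / (10 * maskFactor)) (hρ : 1 ≤ ρ)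
    (hρε : ε * ρ ^ k = 1) (hτ : 0 < τ) (hτ1 : τ < 1) (hn0 : 0 < n)
    (hn : 64 * 2 ^ T / ε ^ 2 * Real.log (2 / τ) ≤ n) :
    (readingEstimator n T ρ (intervalConstant maskFactor (momentConstant k) * (ε * ρ))).EstimatesMean
      (Measure.pi D) ε (5 * intervalConstant maskFactor (momentConstant k) * (ε * ρ)) τ := by
  intro κ hκ
  have hκ1 : IsProbabilityMeasure κ := by
    have : IsProbabilityMeasure (κ.map Prod.fst) := by rw [hκ.clean]; infer_instance
    exact ⟨by
      have h := this.measure_univ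
      rwa [Measure.map_apply measurable_fst MeasurableSet.univ] at h⟩
  have := fun t => isProbabilityMeasure_readingLaw one_le_maskFactor (D t)
  set P := Measure.pi fun t => readingLaw maskFactor (D t) with hP
  set S : Measure (Fin n → Fin T → ℝ × Bool) :=
    Measure.pi fun _ : Fin n => Measure.pi fun _ : Fin T => coordinateSeedLaw
  have hmeas : Measurable fun q : (Samples n T × Samples n T) × (Fin n → Fin T → ℝ × Bool) =>
      readings q.2 q.1.1 :=
    measurable_readings.comp (f := fun q : (Samples n T × Samples n T) ×
      (Fin n → Fin T → ℝ × Bool) => (q.2, q.1.1)) (by fun_prop)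
  have hprob := ofReal_one_sub_le_empiricalDeviation_readingLaw hk hD hε hτ hτ1 hn
  rw [← map_readings hκ.clean, Measure.map_apply hmeas MeasurableSet.of_discrete] at hprob
  refine hprob.trans (measure_mono_ae ?_)
  have hcor : ∀ᵐ q ∂(κ.prod S), IsCorruptedVersion ε q.1.1 q.1.2 :=
    (Measure.quasiMeasurePreserving_fst (μ := κ) (ν := S)).ae hκ.corrupted
  filter_upwards [hcor] with q hq hdev
  have hdev' : empiricalDeviation P (readings q.2 q.1.1) ≤ ε := hdev
  have hclose : EmpiricallyClose (readings q.2 q.1.2) P (3 * ε) := by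
    refine EmpiricallyClose.of_corrupted hn0 hdev' (le_trans ?_ hq)
    -- Clean and corrupted data are read with the same seed, so an untouched data point keeps its
    -- readings.
    refine Nat.cast_le.mpr (Set.ncard_le_ncard (fun i hi hx => hi ?_) (Set.toFinite _))
    ext1 r
    change reading (q.1.1 i r, _) = reading (q.1.2 i r, _)
    rw [hx]
  have hmc : 1 ≤ momentConstant k := by
    rw [momentConstant]
    have : (0 : ℝ) ≤ 2 ^ (k - 1) * (1 + 13 ^ k) := by positivity
    linarith
  have hfin := sum_sq_readingEstimate_sub_le hn0 one_le_maskFactor hmc hρ hε hε8 hεN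
    (fun t => isReadingLaw_readingLaw hk (hD t) one_le_maskFactor (by linarith) hρε) hclose
  have hmean : meanVector (Measure.pi D) = fun t => ∫ y, y ∂(D t) := by
    ext t
    exact integral_comp_eval (μ := D) (i := t) (f := fun y => y) aestronglyMeasurable_id
  change euclideanError _ _ ≤ _
  rw [hmean, euclideanError]
  refine Real.sqrt_le_iff.mpr ⟨?_, hfin⟩
  have hN := one_le_maskFactor
  have : 0 ≤ intervalConstant maskFactor (momentConstant k) := by
    rw [intervalConstant]; positivity
  positivity

end Estimator

theorem corollary4p14 :
    ∃ ε₀ : ℝ, 0 < ε₀ ∧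
      ∀ k : ℕ, 4 ≤ k →
        ∃ (C K : ℝ) (c : ℕ), 0 < C ∧ 0 < K ∧
          ∀ (T : ℕ) (ε τ : ℝ), 1 ≤ T → 0 < ε → ε ≤ ε₀ → 0 < τ → τ < 1 →
            ∀ n : ℕ, 2 ^ T * (K * ((T : ℝ) / ε) ^ c) * Real.log (2 / τ) ≤ (n : ℝ) →
              ∃ A : OnlineEstimator n T,
                ∀ D : Fin T → Measure ℝ, (∀ t, IsProbabilityMeasure (D t)) →
                  (∀ t, CentralMomentLeOne k (D t)) →
                    A.EstimatesMean (Measure.pi D) ε (C * ε ^ (1 - 1 / (k : ℝ))) τ := by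
  have hN := one_le_maskFactor
  -- Chosen so that `3 * ε ≤ 1 / (10 * maskFactor)`, which finding the rough centre requires.
  refine ⟨1 / (30 * maskFactor), by positivity, fun k hk => ?_⟩
  have hC : 0 < intervalConstant maskFactor (momentConstant k) := by
    have : 0 < momentConstant k := by rw [momentConstant]; positivity
    rw [intervalConstant]
    positivity
  -- The sample bound needs only `64 * 2 ^ T / ε ^ 2`; replacing `1 / ε` by `T / ε` is harmless as
  -- `T ≥ 1`, so `K = 64` and `c = 2` work.
  refine ⟨5 * intervalConstant maskFactor (momentConstant k), 64, 2, by positivity, by norm_num, ?_⟩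
  intro T ε τ hT hε hε0 hτ hτ1 n hn
  have hk0 : (k : ℝ) ≠ 0 := by
    have : 0 < k := by omega
    positivity
  have hε30 : ε ≤ 1 / 30 := hε0.trans (by gcongr; linarith)
  have hεN : 3 * ε ≤ 1 / (10 * maskFactor) := by
    have : 1 / (10 * maskFactor) = 3 * (1 / (30 * maskFactor)) := by field_simp; norm_num
    linarith
  have hlog : 0 < Real.log (2 / τ) := Real.log_pos (by rw [lt_div_iff₀ hτ]; linarith)
  have hT1 : (1 : ℝ) ≤ T := by exact_mod_cast hT
  have hn' : 64 * 2 ^ T / ε ^ 2 * Real.log (2 / τ) ≤ n := by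
    refine le_trans ?_ hn
    have : 64 * 2 ^ T / ε ^ 2 = 2 ^ T * (64 * (1 / ε) ^ 2) := by field_simp
    rw [this]
    gcongr
  have hn0 : 0 < n := by
    have : (0 : ℝ) < n := lt_of_lt_of_le (by positivity) hn'
    exact_mod_cast this
  -- This threshold balances the clipping bias, of order `ρ ^ (1 - k)`, against the effect `ε * ρ`
  -- of the corruption.
  set ρ := ε ^ (-(1 / (k : ℝ))) with hρdef
  have hρ : 1 ≤ ρ := Real.one_le_rpow_of_pos_of_le_one_of_nonpos hε (by linarith)
    (neg_nonpos.mpr (by positivity))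
  have hρε : ε * ρ ^ k = 1 := by
    rw [hρdef, ← Real.rpow_natCast, ← Real.rpow_mul hε.le, neg_mul, one_div_mul_cancel hk0,
      Real.rpow_neg_one, mul_inv_cancel₀ hε.ne']
  have hE : ε * ρ = ε ^ (1 - 1 / (k : ℝ)) := by
    rw [hρdef, sub_eq_add_neg, Real.rpow_add hε, Real.rpow_one]
  refine ⟨readingEstimator n T ρ (intervalConstant maskFactor (momentConstant k) * (ε * ρ)),
    fun D hDp hD => ?_⟩
  rw [← hE]
  exact estimatesMean_readingEstimator (by omega) hD hε (by linarith) hεN hρ hρε hτ hτ1 hn0 hn'
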